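/- Let $d,m\ge 0$ be integers, let $b_t:\mathbb R^d\to\mathbb R^d$ and $\sigma_t:\mathbb R^d\to\mathbb R^{d\times m}$ ($t\ge 0$), and consider the Euler scheme $$\hat X_{(n+1)h}=\hat X_{nh}+h\,b_{nh}(\hat X_{nh})+\sqrt h\,\sigma_{nh}(\hat X_{nh})\,\xi_n ,\qquad h>0,$$ where $\xi_0,\xi_1,\dots$ are i.i.d. standard Gaussian vectors in $\mathbb R^m$. For $S\ge 0$, say that $(\mathrm A_S)$ holds with constants $\alpha\in\mathbb R$ and $\lambda,\beta,\Lambda>0$ if for all $x,y\in\mathbb R^d$ and $t\in[0,S]$ $$\langle b_t(x)-b_t(y),x-y\rangle+\tfrac12\|\sigma_t(x)-\sigma_t(y)\|_{\rm HS}^2\le-\alpha\|x-y\|^2,\qquad \lambda I\preceq\sigma_t(x)\sigma_t(x)^{\mathsf T}\preceq\Lambda I,\qquad \|b_t(x)-b_t(y)\|\le\beta\|x-y\| .$$ Fix $x,y\in\mathbb R^d$ and let $\hat\mu_{nh}$, $\hat\nu_{nh}$ denote the laws of $\hat X_{nh}$ when the scheme is started from $x$ and from $y$, respectively. (1) Let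 $h>0$ and $N\ge1$, suppose that $(\mathrm A_{Nh})$ holds, and let $L>0$ satisfy $L^2=1-2\alpha h+\beta^2h^2$. If $L\ne1$, then $$\mathsf{KL}(\hat\mu_{Nh}\,\|\,\hat\nu_{Nh})\le\Bigl(1+\frac{4(\beta-\alpha)(\Lambda/\lambda)^3h}{L^2}\Bigr)\frac{\alpha-\beta^2h/2}{\lambda\,(L^{-2N}-1)}\,\|x-y\|^2 .$$ If $L=1$, the same bound holds with the second factor replaced by its limiting value $\frac1{2\lambda Nh}$. If $L<1$, then in particular $$\mathsf{KL}(\hat\mu_{Nh}\,\|\,\hat\nu_{Nh})\le\Bigl(1+\frac{4(\beta-\alpha)(\Lambda/\lambda)^3h}{L^2}\Bigr)\frac{\alpha\,(1-\beta h/2)}{\lambda\,(L^{-2N}-1)}\,\|x-y\|^2 .$$ (2) Let $T>0$, suppose that $(\mathrm A_S)$ holds, and let $h_k>0$, $N_k\in\mathbb N$ satisfy $h_k\to0$, $N_kh_k\to T$ and $N_kh_k\le S$ for all $k$. If the laws of the schemes with step size $h_k$ after $N_k$ steps, started from $x$ and from $y$, converge weakly to probability measures $\mu_T$ and $\nu_T$,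 respectively (the laws at time $T$ of the SDE $\mathrm dX_t=b_t(X_t)\,\mathrm dt+\sigma_t(X_t)\,\mathrm dB_t$ whenever the Euler scheme converges weakly to it), then $$\mathsf{KL}(\mu_T\,\|\,\nu_T)\le\frac{\alpha\,\|x-y\|^2}{\lambda\,(e^{2\alpha T}-1)},$$ where for $\alpha=0$ the right-hand side is read as its limiting value $\frac{\|x-y\|^2}{2\lambda T}$. -/

import Mathlib

open MeasureTheory ProbabilityTheory Filter Topology InformationTheory
open scoped BoundedContinuousFunction

namespace MultNoise

/-- The squared Hilbert–Schmidt norm of a real matrix. -/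
def hsNormSq {d m : ℕ} (A : Matrix (Fin d) (Fin m) ℝ) : ℝ :=
  ∑ i, ∑ j, A i j ^ 2

/-- Monotonicity (with constant `α : ℝ`) and uniform ellipticity (with constant `lam > 0`) of the
coefficients `b`, `σ` on the time interval `[0, T]`. -/
structure MonotoneElliptic {d m : ℕ}
    (b : ℝ → EuclideanSpace ℝ (Fin d) → EuclideanSpace ℝ (Fin d))
    (σ : ℝ → EuclideanSpace ℝ (Fin d) → Matrix (Fin d) (Fin m) ℝ)
    (T α lam : ℝ) : Prop where
  monotone : ∀ t ∈ Set.Icc 0 T, ∀ x y : EuclideanSpace ℝ (Fin d),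
    inner ℝ (b t x - b t y) (x - y) + 1 / 2 * hsNormSq (σ t x - σ t y) ≤ -α * ‖x - y‖ ^ 2
  lam_pos : 0 < lam
  elliptic : ∀ t ∈ Set.Icc 0 T, ∀ x : EuclideanSpace ℝ (Fin d),
    (σ t x * (σ t x).transpose - lam • (1 : Matrix (Fin d) (Fin d) ℝ)).PosSemidef

/-- Lipschitz drift (with constant `β > 0`) and upper bound `Lam > 0` on the diffusion matrix, on the
time interval `[0, T]`. -/
structure LipschitzBounded {d m : ℕ}
    (b : ℝ → EuclideanSpace ℝ (Fin d) → EuclideanSpace ℝ (Fin d))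
    (σ : ℝ → EuclideanSpace ℝ (Fin d) → Matrix (Fin d) (Fin m) ℝ)
    (T β Lam : ℝ) : Prop where
  beta_pos : 0 < β
  Lam_pos : 0 < Lam
  lipschitz : ∀ t ∈ Set.Icc 0 T, ∀ x y : EuclideanSpace ℝ (Fin d),
    ‖b t x - b t y‖ ≤ β * ‖x - y‖
  bounded : ∀ t ∈ Set.Icc 0 T, ∀ x : EuclideanSpace ℝ (Fin d),
    (Lam • (1 : Matrix (Fin d) (Fin d) ℝ) - σ t x * (σ t x).transpose).PosSemidef

/-- The Euler scheme with step size `h`, started from `x` and driven by the noise `ξ`: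
`euler b σ h ξ x n` is the random vector at time `n * h`. -/
noncomputable def euler {d m : ℕ} {Ω : Type*}
    (b : ℝ → EuclideanSpace ℝ (Fin d) → EuclideanSpace ℝ (Fin d))
    (σ : ℝ → EuclideanSpace ℝ (Fin d) → Matrix (Fin d) (Fin m) ℝ)
    (h : ℝ) (ξ : ℕ → Ω → EuclideanSpace ℝ (Fin m)) (x : EuclideanSpace ℝ (Fin d)) :
    ℕ → Ω → EuclideanSpace ℝ (Fin d)
  | 0 => fun _ => x
  | n + 1 => fun ω =>
      euler b σ h ξ x n ω + h • b (n * h) (euler b σ h ξ x n ω) +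
        Real.sqrt h •
          WithLp.toLp 2 ((σ (n * h) (euler b σ h ξ x n ω)).mulVec (WithLp.ofLp (ξ n ω)))

/-- Weak convergence of a sequence of measures on `ℝ^d`, tested on bounded continuous functions. -/
def WeaklyTendsto {d : ℕ} (ρ : ℕ → Measure (EuclideanSpace ℝ (Fin d)))
    (μ : Measure (EuclideanSpace ℝ (Fin d))) : Prop :=
  ∀ f : EuclideanSpace ℝ (Fin d) →ᵇ ℝ,
    Tendsto (fun k => ∫ z, f z ∂(ρ k)) atTop (𝓝 (∫ z, f z ∂μ))

end MultNoise

/-!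
Relative entropy is handled through its Donsker–Varadhan dual, in which bounds compose along
kernels and pass to weak limits. One Euler step is regularizing: from two starting points it
produces Gaussians with different means and covariances, and after whitening one of them and
diagonalizing, ellipticity bounds their relative entropy by a multiple `C` of the squared distance.
It also contracts, by `L²` in mean square, under the coupling that uses the same noise. Comparing
the two chains through a shifted intermediate point and optimizing the shift, the constants of
consecutive steps add harmonically, so `N` steps have constant `C / ∑_{i<N} L^{-2i}`. Both bounds
are evaluations of this quotient: for fixed `h` the sum is geometric, and as `h → 0` it satisfies
`h ∑_{i<N} L^{-2i} → (e^{2αT} - 1) / (2α)`.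
-/

namespace MultNoise

section DonskerVaradhan

variable {𝓧 𝓨 𝓩 : Type*} [MeasurableSpace 𝓧] [MeasurableSpace 𝓨] [MeasurableSpace 𝓩]

/-- The bound `klDiv μ ν ≤ C` in its dual (Donsker–Varadhan) form, tested on bounded measurable
functions. It composes along kernels and passes to weak limits without any discussion of absolute
continuity; `DVBound.klDiv_le` converts it back. -/
def DVBound (μ ν : Measure 𝓧) (C : ℝ) : Prop :=
  ∀ (f : 𝓧 → ℝ) (M : ℝ), Measurable f → (∀ x, |f x| ≤ M) →
    ∫ x, f x ∂μ ≤ C + Real.log (∫ x, Real.exp (f x) ∂ν)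

lemma integrable_of_abs_le {μ : Measure 𝓧} [IsFiniteMeasure μ] {f : 𝓧 → ℝ} {M : ℝ}
    (hf : Measurable f) (hM : ∀ x, |f x| ≤ M) : Integrable f μ :=
  .of_bound hf.aestronglyMeasurable M (ae_of_all _ hM)

lemma integrable_exp_of_abs_le {μ : Measure 𝓧} [IsFiniteMeasure μ] {f : 𝓧 → ℝ} {M : ℝ}
    (hf : Measurable f) (hM : ∀ x, |f x| ≤ M) : Integrable (fun x => Real.exp (f x)) μ :=
  integrable_of_abs_le (M := Real.exp M) hf.exp fun x => by
    rw [Real.abs_exp]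
    exact Real.exp_le_exp.2 (le_of_abs_le (hM x))

lemma abs_log_integral_exp_le {μ : Measure 𝓧} [IsProbabilityMeasure μ] {f : 𝓧 → ℝ} {M : ℝ}
    (hf : Measurable f) (hM : ∀ x, |f x| ≤ M) : |Real.log (∫ x, Real.exp (f x) ∂μ)| ≤ M := by
  have hint := integrable_exp_of_abs_le (μ := μ) hf hM
  have hlower : Real.exp (-M) ≤ ∫ x, Real.exp (f x) ∂μ := by
    simpa using integral_mono (integrable_const (Real.exp (-M))) hint
      fun x => Real.exp_le_exp.2 (neg_le_of_abs_le (hM x))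
  have hupper : ∫ x, Real.exp (f x) ∂μ ≤ Real.exp M := by
    simpa using integral_mono hint (integrable_const (Real.exp M))
      fun x => Real.exp_le_exp.2 (le_of_abs_le (hM x))
  have hpos := integral_exp_pos hint
  exact abs_le.2 ⟨(Real.le_log_iff_exp_le hpos).2 hlower, (Real.log_le_iff_le_exp hpos).2 hupper⟩

lemma integral_le_log_integral_exp {μ : Measure 𝓧} [IsProbabilityMeasure μ] {g : 𝓧 → ℝ}
    (hg : Integrable g μ) (hexp : Integrable (fun x => Real.exp (g x)) μ) :
    ∫ x, g x ∂μ ≤ Real.log (∫ x, Real.exp (g x) ∂μ) :=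
  (Real.le_log_iff_exp_le (integral_exp_pos hexp)).2 <|
    convexOn_exp.map_integral_le Real.continuous_exp.continuousOn isClosed_univ
      (ae_of_all _ fun _ => Set.mem_univ _) hg hexp

lemma integral_comp_measure {μ : Measure 𝓧} {κ : Kernel 𝓧 𝓨} {f : 𝓨 → ℝ}
    (hf : Integrable f (κ ∘ₘ μ)) : ∫ y, f y ∂(κ ∘ₘ μ) = ∫ x, ∫ y, f y ∂κ x ∂μ := by
  rw [Measure.comp_eq_comp_const_apply] at hf ⊢
  rw [Kernel.integral_comp hf, Kernel.const_apply]

lemma DVBound.refl (μ : Measure 𝓧) [IsProbabilityMeasure μ] : DVBound μ μ 0 := by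
  intro f M hf hM
  simpa using integral_le_log_integral_exp (integrable_of_abs_le (μ := μ) hf hM)
    (integrable_exp_of_abs_le hf hM)

lemma DVBound.mono {μ ν : Measure 𝓧} {C D : ℝ} (h : DVBound μ ν C) (hCD : C ≤ D) :
    DVBound μ ν D := fun f M hf hM => (h f M hf hM).trans (by gcongr)

lemma dvBound_withDensity_exp_neg {μ : Measure 𝓧} [IsProbabilityMeasure μ] {l : 𝓧 → ℝ}
    (hl : Measurable l) (hint : Integrable l μ)
    [IsFiniteMeasure (μ.withDensity fun x => ENNReal.ofReal (Real.exp (-l x)))] :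
    DVBound μ (μ.withDensity fun x => ENNReal.ofReal (Real.exp (-l x))) (∫ x, l x ∂μ) := by
  intro f M hf hM
  have hdens : Measurable fun x => ENNReal.ofReal (Real.exp (-l x)) := by fun_prop
  have hsmul : ∀ x, (ENNReal.ofReal (Real.exp (-l x))).toReal • Real.exp (f x) =
      Real.exp (f x - l x) := fun x => by
    rw [ENNReal.toReal_ofReal (Real.exp_pos _).le, smul_eq_mul, ← Real.exp_add, neg_add_eq_sub]
  have hexp : Integrable (fun x => Real.exp (f x - l x)) μ := by
    simpa only [hsmul] using
      (integrable_withDensity_iff_integrable_smul' hdens (by simp)).1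
        (integrable_exp_of_abs_le hf hM)
  have hf_int := integrable_of_abs_le (μ := μ) hf hM
  have hJensen := integral_le_log_integral_exp (hf_int.sub hint) hexp
  rw [integral_withDensity_eq_integral_toReal_smul hdens (by simp)]
  simp only [hsmul]
  simp only [Pi.sub_apply] at hJensen
  rw [integral_sub hf_int hint] at hJensen
  linarith

lemma DVBound.map {μ ν : Measure 𝓧} {C : ℝ} (h : DVBound μ ν C) {T : 𝓧 → 𝓨} (hT : Measurable T) :
    DVBound (μ.map T) (ν.map T) C := by
  intro f M hf hM
  rw [integral_map hT.aemeasurable hf.aestronglyMeasurable,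
    integral_map hT.aemeasurable (by fun_prop)]
  exact h _ M (hf.comp hT) fun x => hM _

/-- The shifted chain rule: taking for `ρ` a coupling and for `T` its second projection, the kernels
are compared along the coupling while only the second marginal is compared with `ν`. -/
lemma DVBound.comp {ρ : Measure 𝓧} [IsProbabilityMeasure ρ] {ν : Measure 𝓨} [IsProbabilityMeasure ν]
    {T : 𝓧 → 𝓨} (hT : Measurable T) {κ : Kernel 𝓧 𝓩} {η : Kernel 𝓨 𝓩} [IsMarkovKernel κ]
    [IsMarkovKernel η] {K : 𝓧 → ℝ} (hK : Integrable K ρ) {C : ℝ}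
    (hκη : ∀ x, DVBound (κ x) (η (T x)) (K x)) (hρν : DVBound (ρ.map T) ν C) :
    DVBound (κ ∘ₘ ρ) (η ∘ₘ ν) ((∫ x, K x ∂ρ) + C) := by
  intro f M hf hM
  set g : 𝓨 → ℝ := fun y => Real.log (∫ z, Real.exp (f z) ∂η y)
  have hg : Measurable g := hf.exp.stronglyMeasurable.integral_kernel.measurable.log
  have hgM : ∀ y, |g y| ≤ M := fun y => abs_log_integral_exp_le hf hM
  have hgT : Integrable (fun x => g (T x)) ρ := integrable_of_abs_le (hg.comp hT) fun x => hgM _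
  have hexp_g : ∀ y, Real.exp (g y) = ∫ z, Real.exp (f z) ∂η y := fun y =>
    Real.exp_log (integral_exp_pos (integrable_exp_of_abs_le hf hM))
  have hinner : Integrable (fun x => ∫ z, f z ∂κ x) ρ :=
    integrable_of_abs_le (M := M) hf.stronglyMeasurable.integral_kernel.measurable fun x => by
      simpa using norm_integral_le_of_norm_le_const (μ := κ x) (f := f) (ae_of_all _ hM)
  calc ∫ z, f z ∂(κ ∘ₘ ρ) = ∫ x, ∫ z, f z ∂κ x ∂ρ :=
        integral_comp_measure (integrable_of_abs_le hf hM)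
    _ ≤ ∫ x, (K x + g (T x)) ∂ρ :=
        integral_mono hinner (hK.add hgT) fun x => hκη x f M hf hM
    _ = (∫ x, K x ∂ρ) + ∫ y, g y ∂(ρ.map T) := by
        rw [integral_add hK hgT, integral_map hT.aemeasurable hg.aestronglyMeasurable]
    _ ≤ (∫ x, K x ∂ρ) + (C + Real.log (∫ y, Real.exp (g y) ∂ν)) := by
        gcongr
        exact hρν g M hg hgM
    _ = (∫ x, K x ∂ρ) + C + Real.log (∫ z, Real.exp (f z) ∂(η ∘ₘ ν)) := by
        rw [integral_comp_measure (integrable_exp_of_abs_le hf hM)]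
        simp only [hexp_g, add_assoc]

lemma DVBound.prod {μ₁ ν₁ : Measure 𝓧} {μ₂ ν₂ : Measure 𝓨} [IsProbabilityMeasure μ₁]
    [IsProbabilityMeasure ν₁] [IsProbabilityMeasure μ₂] [IsProbabilityMeasure ν₂] {C₁ C₂ : ℝ}
    (h₁ : DVBound μ₁ ν₁ C₁) (h₂ : DVBound μ₂ ν₂ C₂) :
    DVBound (μ₁.prod μ₂) (ν₁.prod ν₂) (C₁ + C₂) := by
  have hfiber (x : 𝓧) :
      DVBound ((Kernel.id ×ₖ Kernel.const 𝓧 μ₂) x) ((Kernel.id ×ₖ Kernel.const 𝓧 ν₂) x) C₂ := by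
    simpa [Kernel.prod_apply, Kernel.id_apply, Measure.dirac_prod] using
      h₂.map (measurable_prodMk_left (x := x))
  have := DVBound.comp measurable_id (integrable_const C₂) hfiber (by simpa using h₁)
  simpa [← Measure.compProd_eq_comp_prod, add_comm C₂] using this

lemma DVBound.pi {n : ℕ} {μ ν : Fin n → Measure 𝓧} [∀ i, IsProbabilityMeasure (μ i)]
    [∀ i, IsProbabilityMeasure (ν i)] {C : Fin n → ℝ} (h : ∀ i, DVBound (μ i) (ν i) (C i)) :
    DVBound (Measure.pi μ) (Measure.pi ν) (∑ i, C i) := by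
  induction n with
  | zero => simpa [Subsingleton.elim μ ν] using DVBound.refl (Measure.pi ν)
  | succ n ih =>
    have hprod := ((h 0).prod (ih fun i => h i.succ)).map
      (MeasurableEquiv.piFinSuccAbove (fun _ => 𝓧) 0).symm.measurable
    have hμ := (measurePreserving_piFinSuccAbove μ 0).symm.map_eq
    have hν := (measurePreserving_piFinSuccAbove ν 0).symm.map_eq
    simp only [Fin.zero_succAbove] at hμ hν
    rwa [hμ, hν, ← Fin.sum_univ_succ] at hprod

lemma DVBound.absolutelyContinuous {μ ν : Measure 𝓧} [IsFiniteMeasure μ] [IsProbabilityMeasure ν]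
    {C : ℝ} (h : DVBound μ ν C) : μ ≪ ν := by
  refine Measure.AbsolutelyContinuous.mk fun A hA hνA => ?_
  have hbound (n : ℕ) : n * μ.real A ≤ C := by
    have hexp : (fun x => Real.exp (A.indicator (fun _ => (n : ℝ)) x)) =ᵐ[ν] fun _ => 1 := by
      filter_upwards [measure_eq_zero_iff_ae_notMem.1 hνA] with x hx
      simp [hx]
    have hDV := h (A.indicator fun _ => (n : ℝ)) n (measurable_const.indicator hA) fun x => by
      by_cases hx : x ∈ A <;> simp [hx]
    rw [integral_congr_ae hexp, integral_indicator_const _ hA] at hDV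
    simpa [mul_comm] using hDV
  by_contra hpos
  have hpos' : 0 < μ.real A := ENNReal.toReal_pos hpos (measure_ne_top μ A)
  obtain ⟨n, hn⟩ := exists_nat_gt (C / μ.real A)
  exact (hbound n).not_gt ((div_lt_iff₀ hpos').1 hn)

/-- The truncation of `r ≥ 0` to `[exp (-n), exp n]`, used to make the logarithm of a density a
bounded test function. -/
noncomputable def expClamp (n : ℕ) (r : ℝ) : ℝ :=
  max (Real.exp (-n)) (min r (Real.exp n))

lemma expClamp_pos (n : ℕ) (r : ℝ) : 0 < expClamp n r :=
  (Real.exp_pos _).trans_le (le_max_left _ _)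

@[fun_prop]
lemma measurable_expClamp (n : ℕ) : Measurable (expClamp n) := by
  unfold expClamp
  fun_prop

lemma abs_log_expClamp_le (n : ℕ) (r : ℝ) : |Real.log (expClamp n r)| ≤ n :=
  abs_le.2 ⟨(Real.le_log_iff_exp_le (expClamp_pos n r)).2 (le_max_left _ _),
    (Real.log_le_iff_le_exp (expClamp_pos n r)).2
      (max_le (Real.exp_le_exp.2 (by simp)) (min_le_right _ _))⟩

lemma expClamp_mul_log_le (n : ℕ) (r : ℝ) :
    expClamp n r * Real.log (expClamp n r) ≤ r * Real.log (expClamp n r) := by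
  have hn : Real.exp (-n) ≤ Real.exp n := Real.exp_le_exp.2 (by simp)
  unfold expClamp
  rcases le_total r (Real.exp (-n)) with hlow | hlow
  · rw [min_eq_left (hlow.trans hn), max_eq_left hlow, Real.log_exp]
    exact mul_le_mul_of_nonpos_right hlow (by simp)
  rcases le_total r (Real.exp n) with hhigh | hhigh
  · rw [min_eq_left hhigh, max_eq_right hlow]
  · rw [min_eq_right hhigh, max_eq_right hn, Real.log_exp]
    exact mul_le_mul_of_nonneg_right hhigh (by simp)

lemma tendsto_expClamp {r : ℝ} (hr : 0 ≤ r) : Tendsto (fun n => expClamp n r) atTop (𝓝 r) := by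
  have hlow : Tendsto (fun n : ℕ => Real.exp (-n)) atTop (𝓝 0) :=
    Real.tendsto_exp_neg_atTop_nhds_zero.comp tendsto_natCast_atTop_atTop
  have hhigh : Tendsto (fun n : ℕ => min r (Real.exp n)) atTop (𝓝 r) :=
    tendsto_const_nhds.congr' <|
      ((Real.tendsto_exp_atTop.comp tendsto_natCast_atTop_atTop).eventually_ge_atTop r).mono
        fun _ hn => (min_eq_left hn).symm
  simpa only [expClamp, max_eq_right hr] using hlow.max hhigh

lemma DVBound.lintegral_klFun_expClamp_le {μ ν : Measure 𝓧} [IsProbabilityMeasure μ]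
    [IsProbabilityMeasure ν] {C : ℝ} (h : DVBound μ ν C) (n : ℕ) :
    ∫⁻ x, ENNReal.ofReal (klFun (expClamp n (μ.rnDeriv ν x).toReal)) ∂ν ≤ ENNReal.ofReal C := by
  set r : 𝓧 → ℝ := fun x => (μ.rnDeriv ν x).toReal
  set c : 𝓧 → ℝ := fun x => expClamp n (r x)
  have hr : Measurable r := (Measure.measurable_rnDeriv μ ν).ennreal_toReal
  have hlog : Measurable fun x => Real.log (c x) := by fun_prop
  have hlogn : ∀ x, |Real.log (c x)| ≤ n := fun x => abs_log_expClamp_le n _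
  have hexp_log : ∀ x, Real.exp (Real.log (c x)) = c x := fun x => Real.exp_log (expClamp_pos n _)
  have hc : Integrable c ν := by
    simpa only [hexp_log] using integrable_exp_of_abs_le (μ := ν) hlog hlogn
  have hrlog : Integrable (fun x => r x * Real.log (c x)) ν := by
    simpa using (integrable_rnDeriv_smul_iff h.absolutelyContinuous).2
      (integrable_of_abs_le (μ := μ) hlog hlogn)
  have hchange : ∫ x, r x * Real.log (c x) ∂ν = ∫ x, Real.log (c x) ∂μ := by
    simpa using integral_rnDeriv_smul h.absolutelyContinuous (f := fun x => Real.log (c x))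
  have hDV := h _ n hlog hlogn
  have hpos := integral_exp_pos (integrable_exp_of_abs_le (μ := ν) hlog hlogn)
  simp only [hexp_log] at hDV hpos
  have hkl_le : ∀ x, klFun (c x) ≤ r x * Real.log (c x) + (1 - c x) := fun x => by
    rw [klFun_apply]
    linarith [expClamp_mul_log_le n (r x)]
  have h1c : Integrable (fun x => 1 - c x) ν := (integrable_const 1).sub hc
  calc ∫⁻ x, ENNReal.ofReal (klFun (c x)) ∂ν
      ≤ ∫⁻ x, ENNReal.ofReal (r x * Real.log (c x) + (1 - c x)) ∂ν :=
        lintegral_mono fun x => ENNReal.ofReal_le_ofReal (hkl_le x)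
    _ = ENNReal.ofReal (∫ x, (r x * Real.log (c x) + (1 - c x)) ∂ν) :=
        (ofReal_integral_eq_lintegral_ofReal (hrlog.add h1c) <| ae_of_all _ fun x =>
          (klFun_nonneg (expClamp_pos n _).le).trans (hkl_le x)).symm
    _ ≤ ENNReal.ofReal C := by
        refine ENNReal.ofReal_le_ofReal ?_
        rw [integral_add hrlog h1c, hchange, integral_sub (integrable_const 1) hc, integral_const,
          probReal_univ, one_smul]
        linarith [Real.log_le_sub_one_of_pos hpos]

theorem DVBound.klDiv_le {μ ν : Measure 𝓧} [IsProbabilityMeasure μ] [IsProbabilityMeasure ν]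
    {C : ℝ} (h : DVBound μ ν C) : klDiv μ ν ≤ ENNReal.ofReal C := by
  set r : 𝓧 → ℝ := fun x => (μ.rnDeriv ν x).toReal
  have hr : Measurable r := (Measure.measurable_rnDeriv μ ν).ennreal_toReal
  have hlim (x : 𝓧) : Tendsto (fun n => ENNReal.ofReal (klFun (expClamp n (r x)))) atTop
      (𝓝 (ENNReal.ofReal (klFun (r x)))) :=
    ENNReal.tendsto_ofReal ((continuous_klFun.tendsto _).comp
      (tendsto_expClamp ENNReal.toReal_nonneg))
  calc klDiv μ ν = ∫⁻ x, ENNReal.ofReal (klFun (r x)) ∂ν :=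
        klDiv_eq_lintegral_klFun_of_ac h.absolutelyContinuous
    _ = ∫⁻ x, liminf (fun n => ENNReal.ofReal (klFun (expClamp n (r x)))) atTop ∂ν :=
        lintegral_congr fun x => (hlim x).liminf_eq.symm
    _ ≤ liminf (fun n => ∫⁻ x, ENNReal.ofReal (klFun (expClamp n (r x))) ∂ν) atTop :=
        lintegral_liminf_le fun n =>
          (measurable_klFun.comp ((measurable_expClamp n).comp hr)).ennreal_ofReal
    _ ≤ ENNReal.ofReal C :=
        liminf_le_of_frequently_le' (Frequently.of_forall h.lintegral_klFun_expClamp_le)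

section Topological

variable {E : Type*} [TopologicalSpace E] [TopologicalSpace.PseudoMetrizableSpace E]
  [MeasurableSpace E] [BorelSpace E]

lemma exists_seq_boundedContinuous_tendsto_ae (μ : Measure E) [IsFiniteMeasure μ] {f : E → ℝ}
    {M : ℝ} (hf : Measurable f) (hM : ∀ x, |f x| ≤ M) :
    ∃ g : ℕ → E →ᵇ ℝ, (∀ n x, |g n x| ≤ M) ∧
      ∀ᵐ x ∂μ, Tendsto (fun n => g n x) atTop (𝓝 (f x)) := by
  have hL1 : MemLp f 1 μ := memLp_one_iff_integrable.2 (integrable_of_abs_le hf hM)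
  have happrox (n : ℕ) : ∃ g : E →ᵇ ℝ, eLpNorm (f - ⇑g) 1 μ ≤ (n + 1 : ENNReal)⁻¹ :=
    (hL1.exists_boundedContinuous_eLpNorm_sub_le ENNReal.one_ne_top (by simp)).imp
      fun _ hg => hg.1
  choose g hg using happrox
  have hmeasure : TendstoInMeasure μ (fun n x => g n x) atTop f := by
    refine tendstoInMeasure_of_tendsto_eLpNorm one_ne_zero
      (fun n => (g n).continuous.measurable.aestronglyMeasurable) hf.aestronglyMeasurable ?_
    refine tendsto_of_tendsto_of_tendsto_of_le_of_le tendsto_const_nhds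
      ?_ (fun _ => zero_le) fun n => (eLpNorm_sub_comm _ _ _ _).trans_le (hg n)
    simpa [Function.comp_def] using ENNReal.tendsto_inv_nat_nhds_zero.comp (tendsto_add_atTop_nat 1)
  obtain ⟨φ, -, hφ⟩ := hmeasure.exists_seq_tendsto_ae
  have hclip (n : ℕ) (x : E) : |max (-M) (min (g (φ n) x) M)| ≤ M :=
    abs_le.2 ⟨le_max_left _ _,
      max_le (by linarith [abs_nonneg (f x), hM x]) (min_le_right _ _)⟩
  have hcont (n : ℕ) : Continuous fun x => max (-M) (min (g (φ n) x) M) := by fun_prop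
  refine ⟨fun n => .ofNormedAddCommGroup _ (hcont n) M (hclip n), hclip, hφ.mono fun x hx => ?_⟩
  have hfx : max (-M) (min (f x) M) = f x := by
    rw [min_eq_left (le_of_abs_le (hM x)), max_eq_right (neg_le_of_abs_le (hM x))]
  have hlim := (tendsto_const_nhds (x := -M)).max (hx.min (tendsto_const_nhds (x := M)))
  rwa [hfx] at hlim

theorem DVBound.of_boundedContinuous {μ ν : Measure E} [IsFiniteMeasure μ] [IsProbabilityMeasure ν]
    {C : ℝ} (h : ∀ f : E →ᵇ ℝ, ∫ x, f x ∂μ ≤ C + Real.log (∫ x, Real.exp (f x) ∂ν)) :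
    DVBound μ ν C := by
  intro f M hf hM
  obtain ⟨g, hgM, hg⟩ := exists_seq_boundedContinuous_tendsto_ae (μ + ν) hf hM
  rw [ae_add_measure_iff] at hg
  have hμ : Tendsto (fun n => ∫ x, g n x ∂μ) atTop (𝓝 (∫ x, f x ∂μ)) :=
    tendsto_integral_of_dominated_convergence (fun _ => M)
      (fun n => (g n).continuous.measurable.aestronglyMeasurable) (integrable_const _)
      (fun n => ae_of_all _ (hgM n)) hg.1
  have hν : Tendsto (fun n => ∫ x, Real.exp (g n x) ∂ν) atTop (𝓝 (∫ x, Real.exp (f x) ∂ν)) := by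
    refine tendsto_integral_of_dominated_convergence (fun _ => Real.exp M)
      (fun n => (g n).continuous.measurable.exp.aestronglyMeasurable) (integrable_const _)
      (fun n => ae_of_all _ fun x => ?_)
      (hg.2.mono fun x hx => (Real.continuous_exp.tendsto _).comp hx)
    rw [Real.norm_eq_abs, Real.abs_exp]
    exact Real.exp_le_exp.2 (le_of_abs_le (hgM n x))
  have hpos := integral_exp_pos (integrable_exp_of_abs_le (μ := ν) hf hM)
  exact le_of_tendsto_of_tendsto' hμ ((hν.log hpos.ne').const_add C) fun n => h (g n)

end Topological

lemma DVBound.of_weaklyTendsto {d : ℕ} {ρ τ : ℕ → Measure (EuclideanSpace ℝ (Fin d))}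
    {μ ν : Measure (EuclideanSpace ℝ (Fin d))} [IsFiniteMeasure μ] [IsProbabilityMeasure ν]
    {C : ℕ → ℝ} {c : ℝ} (h : ∀ᶠ k in atTop, DVBound (ρ k) (τ k) (C k))
    (hρ : WeaklyTendsto ρ μ) (hτ : WeaklyTendsto τ ν) (hC : Tendsto C atTop (𝓝 c)) :
    DVBound μ ν c := by
  refine .of_boundedContinuous fun f => ?_
  have hexp (x) : ‖Real.exp (f x)‖ ≤ Real.exp ‖f‖ := by
    rw [Real.norm_eq_abs, Real.abs_exp]
    exact Real.exp_le_exp.2 (le_of_abs_le (f.norm_coe_le_norm x))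
  have hlim := hτ (.ofNormedAddCommGroup (fun x => Real.exp (f x)) (by fun_prop) _ hexp)
  have hpos : 0 < ∫ x, Real.exp (f x) ∂ν :=
    integral_exp_pos (integrable_exp_of_abs_le f.continuous.measurable f.norm_coe_le_norm)
  exact le_of_tendsto_of_tendsto (hρ f) (hC.add (hlim.log hpos.ne')) <|
    h.mono fun k hk => hk f ‖f‖ f.continuous.measurable f.norm_coe_le_norm

end DonskerVaradhan

section ShiftedComposition

variable {E : Type*} [NormedAddCommGroup E] [MeasurableSpace E]

/-- The entropic regularity of a Markov kernel: its laws from two starting points are within `C`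
times the squared distance in relative entropy (in the form `DVBound`). -/
def Regularizing (κ : Kernel E E) (C : ℝ) : Prop :=
  ∀ x y, DVBound (κ x) (κ y) (C * ‖x - y‖ ^ 2)

/-- The Wasserstein contraction of a Markov kernel: its laws from two starting points admit a
coupling whose mean squared distance is at most `q` times the initial squared distance. -/
def MeanSquareContracting (κ : Kernel E E) (q : ℝ) : Prop :=
  ∀ x y, ∃ π : Measure (E × E), π.map Prod.fst = κ x ∧ π.map Prod.snd = κ y ∧
    Integrable (fun p => ‖p.1 - p.2‖ ^ 2) π ∧ ∫ p, ‖p.1 - p.2‖ ^ 2 ∂π ≤ q * ‖x - y‖ ^ 2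

lemma DVBound.comp_of_meanSquareContracting {Q κ : Kernel E E} [IsMarkovKernel Q] [IsMarkovKernel κ]
    {K q C : ℝ} (hK : 0 ≤ K) (hQ : Regularizing Q K) (hκ : MeanSquareContracting κ q) {w y : E}
    (hwy : DVBound (κ w) (κ y) C) (x : E) :
    DVBound ((Q ∘ₖ κ) x) ((Q ∘ₖ κ) y) (K * q * ‖x - w‖ ^ 2 + C) := by
  obtain ⟨π, hfst, hsnd, hint, hle⟩ := hκ x w
  have : IsProbabilityMeasure (π.map Prod.fst) := hfst ▸ inferInstance
  have : IsProbabilityMeasure π := Measure.isProbabilityMeasure_of_map Prod.fst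
  have hbound : DVBound ((Q.comap Prod.fst measurable_fst : Kernel (E × E) E) ∘ₘ π) (Q ∘ₘ κ y)
      ((∫ p, K * ‖p.1 - p.2‖ ^ 2 ∂π) + C) :=
    DVBound.comp measurable_snd (hint.const_mul K) (fun p => hQ p.1 p.2) (by rwa [hsnd])
  have hfst_comp : (Q.comap Prod.fst measurable_fst : Kernel (E × E) E) ∘ₘ π = Q ∘ₘ κ x := by
    rw [← hfst, ← Measure.deterministic_comp_eq_map measurable_fst, Measure.comp_assoc,
      Kernel.comp_deterministic_eq_comap]
  rw [hfst_comp, integral_const_mul] at hbound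
  rw [Kernel.comp_apply, Kernel.comp_apply]
  refine hbound.mono ?_
  rw [mul_assoc]
  gcongr

/-- Regularities compose harmonically, `1 / C' = 1 / C + 1 / (K q)`: the second starting point is
shifted to the point between `x` and `y` that balances the two contributions. -/
lemma Regularizing.comp [NormedSpace ℝ E] {Q κ : Kernel E E} [IsMarkovKernel Q] [IsMarkovKernel κ]
    {K q C : ℝ} (hK : 0 < K) (hq : 0 < q) (hC : 0 < C) (hQ : Regularizing Q K)
    (hκ : Regularizing κ C) (hκq : MeanSquareContracting κ q) :
    Regularizing (Q ∘ₖ κ) (C⁻¹ + (K * q)⁻¹)⁻¹ := by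
  intro x y
  set η : ℝ := K * q / (C + K * q) with hη
  set w : E := y + η • (x - y) with hw
  have hxw : ‖x - w‖ ^ 2 = (1 - η) ^ 2 * ‖x - y‖ ^ 2 := by
    rw [hw, show x - (y + η • (x - y)) = (1 - η) • (x - y) by module, norm_smul, mul_pow,
      Real.norm_eq_abs, sq_abs]
  have hwy : ‖w - y‖ ^ 2 = η ^ 2 * ‖x - y‖ ^ 2 := by
    rw [hw, add_sub_cancel_left, norm_smul, mul_pow, Real.norm_eq_abs, sq_abs]
  refine (DVBound.comp_of_meanSquareContracting hK.le hQ hκq (hκ w y) x).mono (le_of_eq ?_)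
  rw [hxw, hwy, hη]
  field_simp
  ring

lemma Regularizing.dvBound_comp_chain [NormedSpace ℝ E] {κ : ℕ → Kernel E E} {C q : ℝ} (hC : 0 < C)
    (hq : 0 < q) {μ ν : ℕ → Measure E} {x y : E} (hμ0 : μ 0 = .dirac x) (hν0 : ν 0 = .dirac y)
    {n : ℕ} (hMarkov : ∀ i < n, IsMarkovKernel (κ i)) (hreg : ∀ i < n, Regularizing (κ i) C)
    (hcon : ∀ i < n, MeanSquareContracting (κ i) q) (hμ : ∀ i < n, μ (i + 1) = κ i ∘ₘ μ i)
    (hν : ∀ i < n, ν (i + 1) = κ i ∘ₘ ν i) {Q : Kernel E E} [IsMarkovKernel Q] {j : ℕ}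
    (hQ : Regularizing Q (C / ∑ i ∈ Finset.range (j + 1), q⁻¹ ^ i)) :
    DVBound (Q ∘ₘ μ n) (Q ∘ₘ ν n)
      (C / (∑ i ∈ Finset.range (j + n + 1), q⁻¹ ^ i) * ‖x - y‖ ^ 2) := by
  induction n generalizing Q j with
  | zero =>
    rw [hμ0, hν0, Measure.dirac_bind Q.measurable, Measure.dirac_bind Q.measurable]
    exact hQ x y
  | succ n ih =>
    have := hMarkov n n.lt_succ_self
    have hsum : 0 < ∑ i ∈ Finset.range (j + 1), q⁻¹ ^ i := by positivity
    have hQκ : Regularizing (Q ∘ₖ κ n) (C / ∑ i ∈ Finset.range (j + 1 + 1), q⁻¹ ^ i) := by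
      convert Regularizing.comp (div_pos hC hsum) hq hC hQ (hreg n n.lt_succ_self)
        (hcon n n.lt_succ_self) using 1
      rw [Finset.sum_range_succ', pow_zero]
      simp only [pow_succ, ← Finset.sum_mul]
      field_simp
      ring
    rw [hμ n n.lt_succ_self, hν n n.lt_succ_self, Measure.comp_assoc, Measure.comp_assoc,
      show j + (n + 1) + 1 = j + 1 + n + 1 by ring]
    exact ih (fun i hi => hMarkov i (by lia)) (fun i hi => hreg i (by lia))
      (fun i hi => hcon i (by lia)) (fun i hi => hμ i (by lia)) (fun i hi => hν i (by lia)) hQκ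

theorem dvBound_of_regularizing_of_contracting [NormedSpace ℝ E] {κ : ℕ → Kernel E E} {C q : ℝ}
    (hC : 0 < C) (hq : 0 < q) {μ ν : ℕ → Measure E} {x y : E} (hμ0 : μ 0 = .dirac x)
    (hν0 : ν 0 = .dirac y) {N : ℕ} (hN : 1 ≤ N) (hMarkov : ∀ n < N, IsMarkovKernel (κ n))
    (hreg : ∀ n < N, Regularizing (κ n) C) (hcon : ∀ n < N, MeanSquareContracting (κ n) q)
    (hμ : ∀ n < N, μ (n + 1) = κ n ∘ₘ μ n) (hν : ∀ n < N, ν (n + 1) = κ n ∘ₘ ν n) :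
    DVBound (μ N) (ν N) (C / (∑ i ∈ Finset.range N, q⁻¹ ^ i) * ‖x - y‖ ^ 2) := by
  obtain ⟨n, rfl⟩ := Nat.exists_eq_add_of_le' hN
  have := hMarkov n n.lt_succ_self
  rw [hμ n n.lt_succ_self, hν n n.lt_succ_self]
  simpa using Regularizing.dvBound_comp_chain (j := 0) hC hq hμ0 hν0
    (fun i hi => hMarkov i (by lia)) (fun i hi => hreg i (by lia)) (fun i hi => hcon i (by lia))
    (fun i hi => hμ i (by lia)) (fun i hi => hν i (by lia))
    (by simpa using hreg n n.lt_succ_self)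

end ShiftedComposition

section StepKernel

variable {𝓧 𝓨 Z : Type*} [MeasurableSpace 𝓧] [MeasurableSpace 𝓨] [MeasurableSpace Z]

/-- The transition kernel of the random recursion `X' = s X ξ` with noise law `γ`; it is the zero
kernel if `s` is not jointly measurable. -/
noncomputable def stepKernel (γ : Measure Z) (s : 𝓧 → Z → 𝓨) : Kernel 𝓧 𝓨 :=
  (Kernel.id ×ₖ Kernel.const 𝓧 γ).map (Function.uncurry s)

variable {γ : Measure Z} [IsProbabilityMeasure γ] {s : 𝓧 → Z → 𝓨}

lemma stepKernel_apply (hs : Measurable (Function.uncurry s)) (x : 𝓧) :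
    stepKernel γ s x = γ.map (s x) := by
  rw [stepKernel, Kernel.map_apply _ hs, Kernel.prod_apply, Kernel.id_apply, Kernel.const_apply,
    Measure.dirac_prod, Measure.map_map hs measurable_prodMk_left]
  rfl

lemma isMarkovKernel_stepKernel (hs : Measurable (Function.uncurry s)) :
    IsMarkovKernel (stepKernel γ s) :=
  Kernel.IsMarkovKernel.map _ hs

lemma stepKernel_comp (hs : Measurable (Function.uncurry s)) (μ : Measure 𝓧) [SFinite μ] :
    stepKernel γ s ∘ₘ μ = (μ.prod γ).map (Function.uncurry s) := by
  rw [stepKernel, ← Measure.map_comp _ _ hs, ← Measure.compProd_eq_comp_prod,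
    Measure.compProd_const]

lemma map_step_eq_stepKernel_comp {Ω : Type*} [MeasurableSpace Ω] {P : Measure Ω}
    [IsProbabilityMeasure P] (hs : Measurable (Function.uncurry s)) {X : Ω → 𝓧} {ξ : Ω → Z}
    (hX : AEMeasurable X P) (hξ : HasLaw ξ γ P) (hind : IndepFun X ξ P) :
    P.map (fun ω => s (X ω) (ξ ω)) = stepKernel γ s ∘ₘ P.map X := by
  rw [stepKernel_comp hs, ← hξ.map_eq, ← hind.map_prod_eq_prod_map_map hX hξ.aemeasurable,
    AEMeasurable.map_map_of_aemeasurable hs.aemeasurable (hX.prodMk hξ.aemeasurable)]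
  rfl

/-- The two laws are coupled by driving both recursions with the same noise. -/
lemma meanSquareContracting_stepKernel {E : Type*} [NormedAddCommGroup E] [MeasurableSpace E]
    [BorelSpace E] [SecondCountableTopology E] {s : E → Z → E}
    (hs : Measurable (Function.uncurry s)) {q : ℝ}
    (hint : ∀ x y, Integrable (fun z => ‖s x z - s y z‖ ^ 2) γ)
    (hle : ∀ x y, ∫ z, ‖s x z - s y z‖ ^ 2 ∂γ ≤ q * ‖x - y‖ ^ 2) :
    MeanSquareContracting (stepKernel γ s) q := by
  intro x y
  have hsx : ∀ x, Measurable (s x) := fun x => hs.comp measurable_prodMk_left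
  have hpair : Measurable fun z => (s x z, s y z) := (hsx x).prodMk (hsx y)
  have hdist : Measurable fun p : E × E => ‖p.1 - p.2‖ ^ 2 := by fun_prop
  refine ⟨γ.map fun z => (s x z, s y z), ?_, ?_, ?_, ?_⟩
  · rw [Measure.map_map measurable_fst hpair, stepKernel_apply hs]
    rfl
  · rw [Measure.map_map measurable_snd hpair, stepKernel_apply hs]
    rfl
  · exact (integrable_map_measure hdist.aestronglyMeasurable hpair.aemeasurable).2 (hint x y)
  · rw [integral_map hpair.aemeasurable hdist.aestronglyMeasurable]
    exact hle x y

end StepKernel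

section RealGaussian

lemma gaussianReal_withDensity_exp {s : ℝ} (hs : 0 < s) (c : ℝ) :
    (gaussianReal c (s ^ 2).toNNReal).withDensity (fun z => ENNReal.ofReal
      (Real.exp (-(-Real.log s - (z - c) ^ 2 / (2 * s ^ 2) + z ^ 2 / 2)))) = gaussianReal 0 1 := by
  have hv : ((s ^ 2).toNNReal : ℝ) = s ^ 2 := Real.coe_toNNReal _ (by positivity)
  have hv0 : (s ^ 2).toNNReal ≠ 0 := (Real.toNNReal_pos.2 (by positivity)).ne'
  rw [gaussianReal_of_var_ne_zero _ hv0, gaussianReal_of_var_ne_zero _ one_ne_zero,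
    ← withDensity_mul _ (measurable_gaussianPDF _ _) (by fun_prop)]
  congr 1
  ext z
  rw [Pi.mul_apply, gaussianPDF, gaussianPDF, ← ENNReal.ofReal_mul (gaussianPDFReal_nonneg _ _ _)]
  congr 1
  simp only [gaussianPDFReal_def, hv, NNReal.coe_one, mul_one, sub_zero]
  rw [mul_assoc, ← Real.exp_add, Real.sqrt_mul (by positivity), Real.sqrt_sq hs.le,
    show -(z - c) ^ 2 / (2 * s ^ 2) + -(-Real.log s - (z - c) ^ 2 / (2 * s ^ 2) + z ^ 2 / 2) =
      Real.log s + -z ^ 2 / 2 by ring, Real.exp_add, Real.exp_log hs]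
  field_simp

lemma integrable_sq_sub_gaussianReal (c a : ℝ) (v : NNReal) :
    Integrable (fun z => (z - a) ^ 2) (gaussianReal c v) :=
  ((memLp_id_gaussianReal 2).sub (memLp_const a)).integrable_sq

lemma integral_sq_sub_gaussianReal (c : ℝ) (v : NNReal) :
    ∫ z, (z - c) ^ 2 ∂(gaussianReal c v) = v := by
  simpa only [variance_eq_integral aemeasurable_id', integral_id_gaussianReal] using
    variance_fun_id_gaussianReal (μ := c) (v := v)

lemma integral_sq_gaussianReal (c : ℝ) (v : NNReal) :
    ∫ z, z ^ 2 ∂(gaussianReal c v) = v + c ^ 2 := by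
  have h := variance_eq_sub (memLp_id_gaussianReal (μ := c) (v := v) 2)
  rw [variance_id_gaussianReal] at h
  simp only [Pi.pow_apply, id_eq, integral_id_gaussianReal] at h
  linarith

lemma dvBound_gaussianReal {s : ℝ} (hs : 0 < s) (c : ℝ) :
    DVBound (gaussianReal c (s ^ 2).toNNReal) (gaussianReal 0 1)
      (-Real.log s + (s ^ 2 - 1 + c ^ 2) / 2) := by
  have hdens := gaussianReal_withDensity_exp hs c
  have hv : ((s ^ 2).toNNReal : ℝ) = s ^ 2 := Real.coe_toNNReal _ (by positivity)
  set γ := gaussianReal c (s ^ 2).toNNReal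
  have hsq : Integrable (fun z => z ^ 2) γ := by
    simpa only [sub_zero] using integrable_sq_sub_gaussianReal c 0 _
  have hcenter : Integrable (fun z => (z - c) ^ 2 / (2 * s ^ 2)) γ :=
    (integrable_sq_sub_gaussianReal c c _).div_const _
  have hlog : Integrable (fun z => -Real.log s - (z - c) ^ 2 / (2 * s ^ 2)) γ :=
    (integrable_const _).sub hcenter
  have hmean : ∫ z, (-Real.log s - (z - c) ^ 2 / (2 * s ^ 2) + z ^ 2 / 2) ∂γ =
      -Real.log s + (s ^ 2 - 1 + c ^ 2) / 2 := by
    rw [integral_add hlog (hsq.div_const _), integral_sub (integrable_const _) hcenter,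
      integral_div, integral_div, integral_sq_sub_gaussianReal, integral_sq_gaussianReal, hv,
      integral_const, probReal_univ, one_smul]
    field_simp
    ring
  have : IsFiniteMeasure (γ.withDensity fun z => ENNReal.ofReal
      (Real.exp (-(-Real.log s - (z - c) ^ 2 / (2 * s ^ 2) + z ^ 2 / 2)))) := by
    rw [hdens]
    infer_instance
  have hint : Integrable (fun z => -Real.log s - (z - c) ^ 2 / (2 * s ^ 2) + z ^ 2 / 2) γ :=
    hlog.add (hsq.div_const 2)
  simpa only [hdens, hmean] using dvBound_withDensity_exp_neg (by fun_prop) hint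

lemma pi_gaussianReal_eq_map {d : ℕ} (c s : Fin d → ℝ) :
    Measure.pi (fun i => gaussianReal (c i) (s i ^ 2).toNNReal) =
      (Measure.pi fun _ : Fin d => gaussianReal 0 1).map fun z i => c i + s i * z i := by
  rw [Measure.pi_map_pi (f := fun i t => c i + s i * t) (fun i => by fun_prop)]
  congr 1
  funext i
  rw [show (fun t : ℝ => c i + s i * t) = (fun t => c i + t) ∘ fun t => s i * t from rfl,
    ← Measure.map_map (by fun_prop) (by fun_prop), gaussianReal_map_const_mul,
    gaussianReal_map_const_add, mul_zero, zero_add, mul_one]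
  congr 1
  ext
  simp [Real.coe_toNNReal _ (sq_nonneg (s i))]

end RealGaussian

section MultivariateGaussian

open Matrix

lemma map_affine_stdGaussian {ι κ : Type*} [Fintype ι] [DecidableEq ι] [Fintype κ]
    (a : EuclideanSpace ℝ ι) (S : Matrix ι κ ℝ) :
    (stdGaussian (EuclideanSpace ℝ κ)).map (fun z => a + WithLp.toLp 2 (S *ᵥ z.ofLp)) =
      multivariateGaussian a (S * Sᵀ) := by
  have hS : (S * Sᵀ).PosSemidef := by
    simpa only [conjTranspose_eq_transpose_of_trivial] using posSemidef_self_mul_conjTranspose S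
  refine Measure.ext_of_charFun (funext fun t => ?_)
  have hadjoint : ∀ z : EuclideanSpace ℝ κ, inner ℝ (WithLp.toLp 2 (S *ᵥ z.ofLp)) t =
      inner ℝ z (WithLp.toLp 2 (Sᵀ *ᵥ t.ofLp)) := fun z => by
    simp only [EuclideanSpace.inner_eq_star_dotProduct, star_trivial]
    rw [mulVec_transpose, dotProduct_mulVec]
  have hnorm : ‖(WithLp.toLp 2 (Sᵀ *ᵥ t.ofLp) : EuclideanSpace ℝ κ)‖ ^ 2 =
      t.ofLp ⬝ᵥ (S * Sᵀ) *ᵥ t.ofLp := by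
    rw [EuclideanSpace.real_norm_sq_eq, ← mulVec_mulVec, dotProduct_mulVec, ← mulVec_transpose]
    simp only [dotProduct, sq]
  rw [charFun_multivariateGaussian hS, ← hnorm, charFun_apply,
    integral_map (Continuous.aemeasurable (by fun_prop)) (by fun_prop)]
  simp only [inner_add_left, hadjoint, Complex.ofReal_add, add_mul, Complex.exp_add,
    integral_const_mul]
  rw [← charFun_apply, charFun_stdGaussian, ← Complex.exp_add, real_inner_comm]
  congr 1
  push_cast
  ring

lemma dvBound_multivariateGaussian {d : ℕ} (A : Matrix (Fin d) (Fin d) ℝ) {s : Fin d → ℝ}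
    (hs : ∀ i, 0 < s i) {a₁ a₂ : EuclideanSpace ℝ (Fin d)} {c : Fin d → ℝ}
    (hc : A *ᵥ c = (a₁ - a₂).ofLp) :
    DVBound (multivariateGaussian a₁ (A * diagonal (s ^ 2) * Aᵀ))
      (multivariateGaussian a₂ (A * Aᵀ))
      (∑ i, (-Real.log (s i) + (s i ^ 2 - 1 + c i ^ 2) / 2)) := by
  have hmap : ∀ (a : EuclideanSpace ℝ (Fin d)) (S : Matrix (Fin d) (Fin d) ℝ),
      (Measure.pi fun _ => gaussianReal 0 1).map (fun z => a + WithLp.toLp 2 (S *ᵥ z)) =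
        multivariateGaussian a (S * Sᵀ) := fun a S => by
    rw [← map_affine_stdGaussian, ← map_pi_eq_stdGaussian,
      Measure.map_map (Continuous.measurable (by fun_prop)) (by fun_prop)]
    rfl
  have hT : Measurable fun z : Fin d → ℝ => a₂ + WithLp.toLp 2 (A *ᵥ z) :=
    Continuous.measurable (by fun_prop)
  have hroot : A * diagonal (s ^ 2) * Aᵀ = A * diagonal s * (A * diagonal s)ᵀ := by
    rw [transpose_mul, diagonal_transpose, Matrix.mul_assoc A (diagonal s),
      ← Matrix.mul_assoc (diagonal s), diagonal_mul_diagonal, Matrix.mul_assoc]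
    simp only [← sq]
    rfl
  have hshift : (fun z : Fin d → ℝ => a₁ + WithLp.toLp 2 ((A * diagonal s) *ᵥ z)) =
      (fun z => a₂ + WithLp.toLp 2 (A *ᵥ z)) ∘ fun z i => c i + s i * z i := by
    funext z
    have : (fun i => c i + s i * z i) = c + diagonal s *ᵥ z := by
      funext i
      rw [Pi.add_apply, mulVec_diagonal]
    rw [Function.comp_apply, this, mulVec_add, hc, mulVec_mulVec, WithLp.toLp_add,
      WithLp.toLp_ofLp, ← add_assoc, add_sub_cancel]
  rw [hroot, ← hmap, ← hmap, hshift, ← Measure.map_map hT (Continuous.measurable (by fun_prop)),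
    ← pi_gaussianReal_eq_map]
  exact (DVBound.pi fun i => dvBound_gaussianReal (hs i) (c i)).map hT

end MultivariateGaussian

section Whitening

open Matrix

open scoped MatrixOrder Matrix.Norms.L2Operator in
lemma exists_simultaneous_diagonalization {d : ℕ} {V₁ V₂ : Matrix (Fin d) (Fin d) ℝ}
    (h₁ : V₁.IsHermitian) (h₂ : V₂.PosDef) :
    ∃ (A : Matrix (Fin d) (Fin d) ℝ) (μ : Fin d → ℝ), IsUnit A.det ∧
      V₁ = A * diagonal μ * Aᵀ ∧ V₂ = A * Aᵀ := by
  obtain ⟨B, hB, hV₂⟩ :=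
    CStarAlgebra.isStrictlyPositive_iff_eq_star_mul_self.1 h₂.isStrictlyPositive
  rw [Matrix.isUnit_iff_isUnit_det] at hB
  rw [star_eq_conjTranspose, conjTranspose_eq_transpose_of_trivial] at hV₂
  have hBt : IsUnit Bᵀ.det := by rwa [det_transpose]
  have hM : (Bᵀ⁻¹ * V₁ * B⁻¹).IsHermitian := by
    rw [IsHermitian, conjTranspose_eq_transpose_of_trivial] at *
    rw [transpose_mul, transpose_mul, h₁, transpose_nonsing_inv, transpose_nonsing_inv,
      transpose_transpose, Matrix.mul_assoc]
  set U : Matrix (Fin d) (Fin d) ℝ := (hM.eigenvectorUnitary : Matrix (Fin d) (Fin d) ℝ)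
  have hUU : U * Uᵀ = 1 := by
    simpa [star_eq_conjTranspose] using Unitary.coe_mul_star_self hM.eigenvectorUnitary
  have hspec : Bᵀ⁻¹ * V₁ * B⁻¹ = U * diagonal hM.eigenvalues * Uᵀ := by
    have := hM.spectral_theorem
    rw [Unitary.conjStarAlgAut_apply] at this
    simpa [star_eq_conjTranspose] using this
  refine ⟨Bᵀ * U, hM.eigenvalues, ?_, ?_, ?_⟩
  · rw [det_mul]
    exact hBt.mul (IsUnit.of_mul_eq_one Uᵀ.det (by rw [← det_mul, hUU, det_one]))
  · calc V₁ = Bᵀ * (Bᵀ⁻¹ * V₁ * B⁻¹) * B := by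
          rw [Matrix.mul_assoc Bᵀ⁻¹, mul_nonsing_inv_cancel_left _ _ hBt, Matrix.mul_assoc,
            nonsing_inv_mul _ hB, Matrix.mul_one]
      _ = Bᵀ * (U * diagonal hM.eigenvalues * Uᵀ) * B := congrArg (Bᵀ * · * B) hspec
      _ = Bᵀ * U * diagonal hM.eigenvalues * (Bᵀ * U)ᵀ := by
          rw [transpose_mul, transpose_transpose]
          simp only [Matrix.mul_assoc]
  · rw [transpose_mul, transpose_transpose, Matrix.mul_assoc, ← Matrix.mul_assoc U, hUU,
      Matrix.one_mul, hV₂]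

variable {d m : ℕ} {lam Lam : ℝ}

lemma mul_dotProduct_self_le {M : Matrix (Fin d) (Fin d) ℝ}
    (h : (M - lam • (1 : Matrix (Fin d) (Fin d) ℝ)).PosSemidef) (v : Fin d → ℝ) :
    lam * (v ⬝ᵥ v) ≤ v ⬝ᵥ M *ᵥ v := by
  have := h.dotProduct_mulVec_nonneg v
  rw [star_trivial, sub_mulVec, dotProduct_sub, smul_mulVec, one_mulVec, dotProduct_smul,
    smul_eq_mul] at this
  linarith

lemma dotProduct_mulVec_le {M : Matrix (Fin d) (Fin d) ℝ}
    (h : (Lam • (1 : Matrix (Fin d) (Fin d) ℝ) - M).PosSemidef) (v : Fin d → ℝ) :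
    v ⬝ᵥ M *ᵥ v ≤ Lam * (v ⬝ᵥ v) := by
  have := h.dotProduct_mulVec_nonneg v
  rw [star_trivial, sub_mulVec, dotProduct_sub, smul_mulVec, one_mulVec, dotProduct_smul,
    smul_eq_mul] at this
  linarith

lemma posDef_of_elliptic {M : Matrix (Fin d) (Fin d) ℝ} (hlam : 0 < lam)
    (h : (M - lam • (1 : Matrix (Fin d) (Fin d) ℝ)).PosSemidef) : M.PosDef := by
  simpa only [sub_add_cancel] using PosDef.posSemidef_add h (PosDef.one.smul hlam)

lemma dotProduct_mul_transpose_mulVec (S : Matrix (Fin d) (Fin m) ℝ) (v : Fin d → ℝ) :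
    v ⬝ᵥ (S * Sᵀ) *ᵥ v = v ᵥ* S ⬝ᵥ v ᵥ* S := by
  rw [← mulVec_mulVec, dotProduct_mulVec, mulVec_transpose]

variable {A : Matrix (Fin d) (Fin d) ℝ}

lemma dotProduct_inv_mulVec_self_le (hlam : 0 < lam) (hA : IsUnit A.det)
    (h : (A * Aᵀ - lam • (1 : Matrix (Fin d) (Fin d) ℝ)).PosSemidef) (u : Fin d → ℝ) :
    A⁻¹ *ᵥ u ⬝ᵥ A⁻¹ *ᵥ u ≤ u ⬝ᵥ u / lam := by
  set w := A⁻¹ *ᵥ u with hw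
  set v := w ᵥ* A⁻¹ with hv
  have hvA : v ᵥ* A = w := by rw [hv, vecMul_vecMul, nonsing_inv_mul _ hA, vecMul_one]
  have hvu : w ⬝ᵥ w = v ⬝ᵥ u := by rw [hv, ← dotProduct_mulVec, ← hw]
  have hvw : lam * (v ⬝ᵥ v) ≤ w ⬝ᵥ w := by
    simpa only [dotProduct_mul_transpose_mulVec, hvA] using mul_dotProduct_self_le h v
  have hsq : 0 ≤ (u - lam • v) ⬝ᵥ (u - lam • v) := by
    simpa only [star_trivial] using dotProduct_star_self_nonneg (u - lam • v)
  simp only [sub_dotProduct, dotProduct_sub, smul_dotProduct, dotProduct_smul, smul_eq_mul,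
    dotProduct_comm u v, ← hvu] at hsq
  rw [le_div_iff₀ hlam]
  nlinarith

lemma row_inv_dotProduct_mulVec (hA : IsUnit A.det) (μ : Fin d → ℝ) (i : Fin d) :
    A⁻¹ i ⬝ᵥ (A * diagonal μ * Aᵀ) *ᵥ A⁻¹ i = μ i := by
  have hrow : A⁻¹ i ᵥ* A = Pi.single i 1 := by
    rw [← mul_apply_eq_vecMul, nonsing_inv_mul _ hA]
    funext j
    rw [one_apply, Pi.single_apply]
    simp only [eq_comm]
  rw [← mulVec_mulVec, ← mulVec_mulVec, mulVec_transpose, hrow, dotProduct_mulVec, hrow]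
  simp

lemma row_inv_dotProduct_mulVec_self (hA : IsUnit A.det) (i : Fin d) :
    A⁻¹ i ⬝ᵥ (A * Aᵀ) *ᵥ A⁻¹ i = 1 := by
  simpa using row_inv_dotProduct_mulVec hA 1 i

lemma inv_sqrt_le_of_elliptic {μ : Fin d → ℝ} (hlam : 0 < lam) (hA : IsUnit A.det)
    (h₁ : (A * diagonal μ * Aᵀ - lam • (1 : Matrix (Fin d) (Fin d) ℝ)).PosSemidef)
    (h₂ : (A * Aᵀ - lam • (1 : Matrix (Fin d) (Fin d) ℝ)).PosSemidef)
    (h₂' : (Lam • (1 : Matrix (Fin d) (Fin d) ℝ) - A * Aᵀ).PosSemidef) (i : Fin d) :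
    0 < μ i ∧ (√(μ i))⁻¹ ≤ Lam / lam := by
  have hlower := row_inv_dotProduct_mulVec hA μ i ▸ mul_dotProduct_self_le h₁ (A⁻¹ i)
  have hone_le := row_inv_dotProduct_mulVec_self hA i ▸ dotProduct_mulVec_le h₂' (A⁻¹ i)
  have hle_one := row_inv_dotProduct_mulVec_self hA i ▸ mul_dotProduct_self_le h₂ (A⁻¹ i)
  set n := A⁻¹ i ⬝ᵥ A⁻¹ i
  have hn : 0 < n := by
    have hn0 : 0 ≤ n := by simpa only [star_trivial] using dotProduct_star_self_nonneg (A⁻¹ i)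
    exact hn0.lt_of_ne' fun h0 => by rw [h0, mul_zero] at hone_le; linarith
  have hμ : 0 < μ i := (mul_pos hlam hn).trans_le hlower
  have hratio : 1 ≤ Lam / lam := by
    rw [one_le_div hlam]
    exact le_of_mul_le_mul_right (hle_one.trans hone_le) hn
  have hinv : (μ i)⁻¹ ≤ Lam / lam := by
    rw [inv_le_comm₀ hμ (by positivity), inv_div]
    refine le_trans ?_ hlower
    rw [div_eq_mul_one_div]
    gcongr
    rw [div_le_iff₀ (lt_of_mul_lt_mul_right (by simpa using one_pos.trans_le hone_le) hn.le)]
    linarith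
  refine ⟨hμ, ?_⟩
  rw [← Real.sqrt_inv]
  exact Real.sqrt_le_iff.2 ⟨by positivity, hinv.trans (le_self_pow₀ hratio two_ne_zero)⟩

lemma sq_sqrt_dotProduct_sub_le {n : ℕ} (p q : Fin n → ℝ) :
    (√(p ⬝ᵥ p) - √(q ⬝ᵥ q)) ^ 2 ≤ (p - q) ⬝ᵥ (p - q) := by
  have hnorm : ∀ r : Fin n → ℝ, √(r ⬝ᵥ r) = ‖WithLp.toLp 2 r‖ := fun r => by
    simp [EuclideanSpace.norm_eq, dotProduct, sq]
  rw [← Real.sqrt_le_sqrt_iff (by simpa using dotProduct_star_self_nonneg (p - q)),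
    Real.sqrt_sq_eq_abs, hnorm, hnorm, hnorm, WithLp.toLp_sub]
  exact abs_norm_sub_norm_le _ _

lemma sum_sq_sqrt_sub_one_le {S₁ S₂ : Matrix (Fin d) (Fin m) ℝ} {μ : Fin d → ℝ} (hlam : 0 < lam)
    (hA : IsUnit A.det) (hell : (A * Aᵀ - lam • (1 : Matrix (Fin d) (Fin d) ℝ)).PosSemidef)
    (h₁ : S₁ * S₁ᵀ = A * diagonal μ * Aᵀ) (h₂ : S₂ * S₂ᵀ = A * Aᵀ) :
    ∑ i, (√(μ i) - 1) ^ 2 ≤ hsNormSq (S₁ - S₂) / lam := by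
  have hrow₁ : ∀ i, (A⁻¹ * S₁) i ⬝ᵥ (A⁻¹ * S₁) i = μ i := fun i => by
    rw [mul_apply_eq_vecMul, ← dotProduct_mul_transpose_mulVec, h₁, row_inv_dotProduct_mulVec hA]
  have hrow₂ : ∀ i, (A⁻¹ * S₂) i ⬝ᵥ (A⁻¹ * S₂) i = 1 := fun i => by
    rw [mul_apply_eq_vecMul, ← dotProduct_mul_transpose_mulVec, h₂,
      row_inv_dotProduct_mulVec_self hA]
  calc ∑ i, (√(μ i) - 1) ^ 2 ≤ ∑ i, (A⁻¹ * (S₁ - S₂)) i ⬝ᵥ (A⁻¹ * (S₁ - S₂)) i :=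
        Finset.sum_le_sum fun i _ => by
          have := sq_sqrt_dotProduct_sub_le ((A⁻¹ * S₁) i) ((A⁻¹ * S₂) i)
          rw [hrow₁, hrow₂, Real.sqrt_one] at this
          rwa [Matrix.mul_sub]
    _ = ∑ k, A⁻¹ *ᵥ (S₁ - S₂).col k ⬝ᵥ A⁻¹ *ᵥ (S₁ - S₂).col k := Finset.sum_comm
    _ ≤ ∑ k, (S₁ - S₂).col k ⬝ᵥ (S₁ - S₂).col k / lam :=
        Finset.sum_le_sum fun k _ => dotProduct_inv_mulVec_self_le hlam hA hell _
    _ = hsNormSq (S₁ - S₂) / lam := by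
        rw [← Finset.sum_div, hsNormSq, Finset.sum_comm]
        simp only [dotProduct, sq, col_apply]

lemma neg_log_add_le_mul_sq_sub_one {s r : ℝ} (hs : 0 < s) (hr : s⁻¹ ≤ r) :
    -Real.log s + (s ^ 2 - 1) / 2 ≤ (1 / 2 + r) * (s - 1) ^ 2 := by
  have hlog := Real.one_sub_inv_le_log_of_pos hs
  calc -Real.log s + (s ^ 2 - 1) / 2 ≤ -(1 - s⁻¹) + (s ^ 2 - 1) / 2 := by linarith
    _ = (1 / 2 + s⁻¹) * (s - 1) ^ 2 := by field_simp; ring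
    _ ≤ (1 / 2 + r) * (s - 1) ^ 2 := by gcongr

theorem dvBound_map_affine_stdGaussian {S₁ S₂ : Matrix (Fin d) (Fin m) ℝ} (hlam : 0 < lam)
    (hLam : 0 ≤ Lam) (h₁ : (S₁ * S₁ᵀ - lam • (1 : Matrix (Fin d) (Fin d) ℝ)).PosSemidef)
    (h₂ : (S₂ * S₂ᵀ - lam • (1 : Matrix (Fin d) (Fin d) ℝ)).PosSemidef)
    (h₂' : (Lam • (1 : Matrix (Fin d) (Fin d) ℝ) - S₂ * S₂ᵀ).PosSemidef)
    (a₁ a₂ : EuclideanSpace ℝ (Fin d)) :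
    DVBound
      ((stdGaussian (EuclideanSpace ℝ (Fin m))).map fun z => a₁ + WithLp.toLp 2 (S₁ *ᵥ z.ofLp))
      ((stdGaussian (EuclideanSpace ℝ (Fin m))).map fun z => a₂ + WithLp.toLp 2 (S₂ *ᵥ z.ofLp))
      (‖a₁ - a₂‖ ^ 2 / (2 * lam) + (1 / 2 + Lam / lam) * (hsNormSq (S₁ - S₂) / lam)) := by
  obtain ⟨A, μ, hA, hV₁, hV₂⟩ := exists_simultaneous_diagonalization
    (posDef_of_elliptic hlam h₁).isHermitian (posDef_of_elliptic hlam h₂)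
  have hcov := sum_sq_sqrt_sub_one_le hlam hA (hV₂ ▸ h₂) hV₁ hV₂
  rw [map_affine_stdGaussian, map_affine_stdGaussian, hV₁, hV₂]
  rw [hV₁] at h₁
  rw [hV₂] at h₂ h₂'
  have hμ := inv_sqrt_le_of_elliptic hlam hA h₁ h₂ h₂'
  set c := A⁻¹ *ᵥ (a₁ - a₂).ofLp with hc
  have hAc : A *ᵥ c = (a₁ - a₂).ofLp := by rw [hc, mulVec_mulVec, mul_nonsing_inv _ hA, one_mulVec]
  have hmean : ∑ i, c i ^ 2 ≤ ‖a₁ - a₂‖ ^ 2 / lam := by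
    simpa only [dotProduct, ← sq, EuclideanSpace.real_norm_sq_eq] using
      dotProduct_inv_mulVec_self_le hlam hA h₂ (a₁ - a₂).ofLp
  have hsqrt : (fun i => √(μ i)) ^ 2 = μ := funext fun i => Real.sq_sqrt (hμ i).1.le
  have hdv := dvBound_multivariateGaussian A (fun i => Real.sqrt_pos.2 (hμ i).1) hAc
  rw [hsqrt] at hdv
  refine hdv.mono ?_
  calc ∑ i, (-Real.log √(μ i) + (√(μ i) ^ 2 - 1 + c i ^ 2) / 2)
      ≤ ∑ i, (c i ^ 2 / 2 + (1 / 2 + Lam / lam) * (√(μ i) - 1) ^ 2) :=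
        Finset.sum_le_sum fun i _ => by
          linarith [neg_log_add_le_mul_sq_sub_one (Real.sqrt_pos.2 (hμ i).1) (hμ i).2]
    _ = (∑ i, c i ^ 2) / 2 + (1 / 2 + Lam / lam) * ∑ i, (√(μ i) - 1) ^ 2 := by
        rw [Finset.sum_add_distrib, Finset.mul_sum, Finset.sum_div]
    _ ≤ ‖a₁ - a₂‖ ^ 2 / lam / 2 + (1 / 2 + Lam / lam) * (hsNormSq (S₁ - S₂) / lam) := by
        gcongr
    _ = _ := by rw [div_div, mul_comm lam 2]

end Whitening

section HilbertSchmidt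

variable {d m : ℕ} (A : Matrix (Fin d) (Fin m) ℝ)

lemma hsNormSq_nonneg : 0 ≤ hsNormSq A :=
  Finset.sum_nonneg fun _ _ => Finset.sum_nonneg fun _ _ => sq_nonneg _

lemma hsNormSq_smul (c : ℝ) : hsNormSq (c • A) = c ^ 2 * hsNormSq A := by
  simp only [hsNormSq, Matrix.smul_apply, smul_eq_mul, mul_pow, Finset.mul_sum]

lemma sq_apply_le_hsNormSq (i : Fin d) (j : Fin m) : A i j ^ 2 ≤ hsNormSq A :=
  (Finset.single_le_sum (f := fun j => A i j ^ 2) (fun _ _ => sq_nonneg _)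
    (Finset.mem_univ j)).trans (Finset.single_le_sum (f := fun i => ∑ j, A i j ^ 2)
      (fun _ _ => Finset.sum_nonneg fun _ _ => sq_nonneg _) (Finset.mem_univ i))

lemma memLp_add_inner_stdGaussian (a : ℝ) (v : EuclideanSpace ℝ (Fin m)) :
    MemLp (fun z => a + inner ℝ v z) 2 (stdGaussian (EuclideanSpace ℝ (Fin m))) :=
  (memLp_const a).add (IsGaussian.memLp_dual _ (innerSL ℝ v) 2 (by simp))

lemma integral_sq_add_inner_stdGaussian (a : ℝ) (v : EuclideanSpace ℝ (Fin m)) :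
    ∫ z, (a + inner ℝ v z) ^ 2 ∂(stdGaussian (EuclideanSpace ℝ (Fin m))) = a ^ 2 + ‖v‖ ^ 2 := by
  set γ := stdGaussian (EuclideanSpace ℝ (Fin m))
  have hmean : ∫ z, (a + inner ℝ v z) ∂γ = a := by
    have hcentered : ∫ z, inner ℝ v z ∂γ = 0 := integral_strongDual_stdGaussian (innerSL ℝ v)
    have hint : Integrable (fun z => inner ℝ v z) γ :=
      (IsGaussian.memLp_dual γ (innerSL ℝ v) 1 (by simp)).integrable le_rfl
    rw [integral_add (integrable_const _) hint, hcentered, integral_const, probReal_univ, one_smul,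
      add_zero]
  have hvar : Var[fun z => a + inner ℝ v z; γ] = ‖v‖ ^ 2 := by
    rw [variance_const_add (by fun_prop)]
    simpa using variance_dual_stdGaussian (innerSL ℝ v)
  rw [variance_eq_sub (memLp_add_inner_stdGaussian a v), hmean] at hvar
  simp only [Pi.pow_apply] at hvar
  linarith

lemma norm_sq_add_toLp_mulVec (a : EuclideanSpace ℝ (Fin d)) (z : EuclideanSpace ℝ (Fin m)) :
    ‖a + WithLp.toLp 2 (A.mulVec z.ofLp)‖ ^ 2 =
      ∑ i, (a i + inner ℝ (WithLp.toLp 2 (A i)) z) ^ 2 := by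
  rw [EuclideanSpace.real_norm_sq_eq]
  refine Finset.sum_congr rfl fun i _ => ?_
  rw [EuclideanSpace.inner_eq_star_dotProduct, star_trivial, dotProduct_comm]
  rfl

lemma integrable_norm_sq_add_mulVec_stdGaussian (a : EuclideanSpace ℝ (Fin d)) :
    Integrable (fun z => ‖a + WithLp.toLp 2 (A.mulVec z.ofLp)‖ ^ 2)
      (stdGaussian (EuclideanSpace ℝ (Fin m))) := by
  simp only [norm_sq_add_toLp_mulVec]
  exact integrable_finsetSum _ fun i _ => (memLp_add_inner_stdGaussian _ _).integrable_sq

lemma integral_norm_sq_add_mulVec_stdGaussian (a : EuclideanSpace ℝ (Fin d)) :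
    ∫ z, ‖a + WithLp.toLp 2 (A.mulVec z.ofLp)‖ ^ 2
      ∂(stdGaussian (EuclideanSpace ℝ (Fin m))) = ‖a‖ ^ 2 + hsNormSq A := by
  simp only [norm_sq_add_toLp_mulVec]
  rw [integral_finsetSum _ fun i _ => (memLp_add_inner_stdGaussian _ _).integrable_sq]
  simp only [integral_sq_add_inner_stdGaussian, EuclideanSpace.real_norm_sq_eq,
    Finset.sum_add_distrib, hsNormSq]

end HilbertSchmidt

section EulerStep

variable {d m : ℕ}

/-- One step of length `h` of the Euler scheme with coefficients `b₀` and `σ₀`, as a function of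
the current position and of the noise. -/
noncomputable def eulerStep (b₀ : EuclideanSpace ℝ (Fin d) → EuclideanSpace ℝ (Fin d))
    (σ₀ : EuclideanSpace ℝ (Fin d) → Matrix (Fin d) (Fin m) ℝ) (h : ℝ)
    (x : EuclideanSpace ℝ (Fin d)) (z : EuclideanSpace ℝ (Fin m)) : EuclideanSpace ℝ (Fin d) :=
  x + h • b₀ x + √h • WithLp.toLp 2 ((σ₀ x).mulVec z.ofLp)

/-- The transition kernel of one step of the Euler scheme. -/
noncomputable def eulerKernel (b₀ : EuclideanSpace ℝ (Fin d) → EuclideanSpace ℝ (Fin d))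
    (σ₀ : EuclideanSpace ℝ (Fin d) → Matrix (Fin d) (Fin m) ℝ) (h : ℝ) :
    Kernel (EuclideanSpace ℝ (Fin d)) (EuclideanSpace ℝ (Fin d)) :=
  stepKernel (stdGaussian (EuclideanSpace ℝ (Fin m))) (eulerStep b₀ σ₀ h)

/-- The factor by which one Euler step contracts mean squared distances, the `L ^ 2` of the
theorem. -/
def eulerContraction (α β h : ℝ) : ℝ := 1 - 2 * α * h + β ^ 2 * h ^ 2

/-- The regularity constant of the transition kernel of one Euler step. -/
noncomputable def eulerRegularity (α lam β Lam h : ℝ) : ℝ :=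
  eulerContraction α β h / (2 * lam * h) + 2 * (β - α) * (Lam / lam) ^ 3 / lam

lemma eulerStep_eq_affine (b₀ : EuclideanSpace ℝ (Fin d) → EuclideanSpace ℝ (Fin d))
    (σ₀ : EuclideanSpace ℝ (Fin d) → Matrix (Fin d) (Fin m) ℝ) (h : ℝ)
    (x : EuclideanSpace ℝ (Fin d)) :
    eulerStep b₀ σ₀ h x =
      fun z => (x + h • b₀ x) + WithLp.toLp 2 ((√h • σ₀ x).mulVec z.ofLp) := by
  funext z
  rw [eulerStep, Matrix.smul_mulVec, WithLp.toLp_smul]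

lemma eulerStep_sub_eulerStep (b₀ : EuclideanSpace ℝ (Fin d) → EuclideanSpace ℝ (Fin d))
    (σ₀ : EuclideanSpace ℝ (Fin d) → Matrix (Fin d) (Fin m) ℝ) (h : ℝ)
    (x y : EuclideanSpace ℝ (Fin d)) (z : EuclideanSpace ℝ (Fin m)) :
    eulerStep b₀ σ₀ h x z - eulerStep b₀ σ₀ h y z = (x + h • b₀ x - (y + h • b₀ y)) +
      WithLp.toLp 2 ((√h • (σ₀ x - σ₀ y)).mulVec z.ofLp) := by
  simp only [eulerStep_eq_affine, smul_sub, Matrix.sub_mulVec, WithLp.toLp_sub]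
  abel

variable {b : ℝ → EuclideanSpace ℝ (Fin d) → EuclideanSpace ℝ (Fin d)}
  {σ : ℝ → EuclideanSpace ℝ (Fin d) → Matrix (Fin d) (Fin m) ℝ} {T α lam β Lam t h : ℝ}

lemma hsNormSq_sub_le (hM : MonotoneElliptic b σ T α lam) (hL : LipschitzBounded b σ T β Lam)
    (ht : t ∈ Set.Icc 0 T) (x y : EuclideanSpace ℝ (Fin d)) :
    hsNormSq (σ t x - σ t y) ≤ 2 * (β - α) * ‖x - y‖ ^ 2 := by
  have hinner : -(β * ‖x - y‖ * ‖x - y‖) ≤ inner ℝ (b t x - b t y) (x - y) :=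
    calc -(β * ‖x - y‖ * ‖x - y‖) ≤ -(‖b t x - b t y‖ * ‖x - y‖) := by
          gcongr
          exact hL.lipschitz t ht x y
      _ ≤ inner ℝ (b t x - b t y) (x - y) :=
        (abs_le.1 (abs_real_inner_le_norm (b t x - b t y) (x - y))).1
  linarith [hM.monotone t ht x y]

lemma alpha_le_beta (hM : MonotoneElliptic b σ T α lam) (hL : LipschitzBounded b σ T β Lam)
    (ht : t ∈ Set.Icc 0 T) {x y : EuclideanSpace ℝ (Fin d)} (hxy : x ≠ y) : α ≤ β := by
  have hdist : 0 < ‖x - y‖ ^ 2 := by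
    have := norm_sub_pos_iff.2 hxy
    positivity
  have : 0 ≤ 2 * (β - α) := nonneg_of_mul_nonneg_left
    ((hsNormSq_nonneg _).trans (hsNormSq_sub_le hM hL ht x y)) hdist
  linarith

lemma lam_le_Lam (hM : MonotoneElliptic b σ T α lam) (hL : LipschitzBounded b σ T β Lam)
    (ht : t ∈ Set.Icc 0 T) {x y : EuclideanSpace ℝ (Fin d)} (hxy : x ≠ y) : lam ≤ Lam := by
  have hpos : 0 < (x - y).ofLp ⬝ᵥ (x - y).ofLp := by
    have := norm_sub_pos_iff.2 hxy
    simp only [dotProduct, ← sq, ← EuclideanSpace.real_norm_sq_eq]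
    positivity
  exact le_of_mul_le_mul_right ((mul_dotProduct_self_le (hM.elliptic t ht x) _).trans
    (dotProduct_mulVec_le (hL.bounded t ht x) _)) hpos

lemma LipschitzBounded.continuous_drift (hL : LipschitzBounded b σ T β Lam)
    (ht : t ∈ Set.Icc 0 T) : Continuous (b t) := by
  refine (LipschitzWith.of_dist_le_mul (K := β.toNNReal) fun x y => ?_).continuous
  rw [Real.coe_toNNReal _ hL.beta_pos.le, dist_eq_norm, dist_eq_norm]
  exact hL.lipschitz t ht x y

lemma continuous_diffusion (hM : MonotoneElliptic b σ T α lam) (hL : LipschitzBounded b σ T β Lam)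
    (ht : t ∈ Set.Icc 0 T) : Continuous (σ t) := by
  refine continuous_matrix fun i j => (LipschitzWith.of_dist_le_mul
    (K := (√(2 * (β - α))).toNNReal) fun x y => ?_).continuous
  rw [Real.coe_toNNReal _ (Real.sqrt_nonneg _), Real.dist_eq, dist_eq_norm,
    ← Real.sqrt_sq (norm_nonneg (x - y)), ← Real.sqrt_mul' _ (sq_nonneg _)]
  exact Real.abs_le_sqrt ((sq_apply_le_hsNormSq (σ t x - σ t y) i j).trans
    (hsNormSq_sub_le hM hL ht x y))

lemma measurable_eulerStep (hM : MonotoneElliptic b σ T α lam) (hL : LipschitzBounded b σ T β Lam)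
    (ht : t ∈ Set.Icc 0 T) (h : ℝ) :
    Measurable (Function.uncurry (eulerStep (b t) (σ t) h)) := by
  have hb := hL.continuous_drift ht
  have hσ := continuous_diffusion hM hL ht
  have : Continuous fun p : EuclideanSpace ℝ (Fin d) × EuclideanSpace ℝ (Fin m) =>
      (σ t p.1).mulVec p.2.ofLp :=
    (hσ.comp continuous_fst).matrix_mulVec (by fun_prop)
  refine Continuous.measurable ?_
  unfold Function.uncurry eulerStep
  fun_prop

lemma isMarkovKernel_eulerKernel (hM : MonotoneElliptic b σ T α lam)
    (hL : LipschitzBounded b σ T β Lam) (ht : t ∈ Set.Icc 0 T) (h : ℝ) :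
    IsMarkovKernel (eulerKernel (b t) (σ t) h) :=
  isMarkovKernel_stepKernel (measurable_eulerStep hM hL ht h)

lemma norm_sq_drift_sub_add_le (hM : MonotoneElliptic b σ T α lam)
    (hL : LipschitzBounded b σ T β Lam) (ht : t ∈ Set.Icc 0 T) (hh : 0 ≤ h)
    (x y : EuclideanSpace ℝ (Fin d)) :
    ‖x + h • b t x - (y + h • b t y)‖ ^ 2 + h * hsNormSq (σ t x - σ t y) ≤
      eulerContraction α β h * ‖x - y‖ ^ 2 := by
  have hlip : ‖b t x - b t y‖ ^ 2 ≤ β ^ 2 * ‖x - y‖ ^ 2 := by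
    rw [← mul_pow]
    exact pow_le_pow_left₀ (norm_nonneg _) (hL.lipschitz t ht x y) 2
  have hexpand : ‖x + h • b t x - (y + h • b t y)‖ ^ 2 = ‖x - y‖ ^ 2 +
      2 * h * inner ℝ (b t x - b t y) (x - y) + h ^ 2 * ‖b t x - b t y‖ ^ 2 := by
    rw [show x + h • b t x - (y + h • b t y) = (x - y) + h • (b t x - b t y) by module,
      norm_add_sq_real, real_inner_smul_right, norm_smul, mul_pow, Real.norm_eq_abs, sq_abs,
      real_inner_comm]
    ring
  calc ‖x + h • b t x - (y + h • b t y)‖ ^ 2 + h * hsNormSq (σ t x - σ t y)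
      = ‖x - y‖ ^ 2 + 2 * h * (inner ℝ (b t x - b t y) (x - y) +
          1 / 2 * hsNormSq (σ t x - σ t y)) + h ^ 2 * ‖b t x - b t y‖ ^ 2 := by
        rw [hexpand]
        ring
    _ ≤ ‖x - y‖ ^ 2 + 2 * h * (-α * ‖x - y‖ ^ 2) + h ^ 2 * (β ^ 2 * ‖x - y‖ ^ 2) := by
        gcongr
        exact hM.monotone t ht x y
    _ = eulerContraction α β h * ‖x - y‖ ^ 2 := by
        rw [eulerContraction]
        ring

lemma meanSquareContracting_eulerKernel (hM : MonotoneElliptic b σ T α lam)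
    (hL : LipschitzBounded b σ T β Lam) (ht : t ∈ Set.Icc 0 T) (hh : 0 ≤ h) :
    MeanSquareContracting (eulerKernel (b t) (σ t) h) (eulerContraction α β h) := by
  refine meanSquareContracting_stepKernel (measurable_eulerStep hM hL ht h) (fun x y => ?_)
    fun x y => ?_
  · simp only [eulerStep_sub_eulerStep]
    exact integrable_norm_sq_add_mulVec_stdGaussian _ _
  · simp only [eulerStep_sub_eulerStep]
    rw [integral_norm_sq_add_mulVec_stdGaussian, hsNormSq_smul, Real.sq_sqrt hh]
    exact norm_sq_drift_sub_add_le hM hL ht hh x y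

lemma sqrt_smul_mul_transpose (hh : 0 ≤ h) (S : Matrix (Fin d) (Fin m) ℝ) :
    (√h • S) * (√h • S).transpose = h • (S * S.transpose) := by
  rw [Matrix.transpose_smul, Matrix.smul_mul, Matrix.mul_smul, smul_smul, Real.mul_self_sqrt hh]

lemma dvBound_eulerStep (hM : MonotoneElliptic b σ T α lam) (hL : LipschitzBounded b σ T β Lam)
    (ht : t ∈ Set.Icc 0 T) (hh : 0 < h) (x y : EuclideanSpace ℝ (Fin d)) :
    DVBound ((stdGaussian (EuclideanSpace ℝ (Fin m))).map (eulerStep (b t) (σ t) h x))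
      ((stdGaussian (EuclideanSpace ℝ (Fin m))).map (eulerStep (b t) (σ t) h y))
      (‖x + h • b t x - (y + h • b t y)‖ ^ 2 / (2 * lam * h) +
        (1 / 2 + Lam / lam) * (hsNormSq (σ t x - σ t y) / lam)) := by
  have hlam := hM.lam_pos
  have hlower : ∀ x, ((√h • σ t x) * (√h • σ t x).transpose -
      (h * lam) • (1 : Matrix (Fin d) (Fin d) ℝ)).PosSemidef := fun x => by
    rw [sqrt_smul_mul_transpose hh.le, mul_smul, ← smul_sub]
    exact (hM.elliptic t ht x).smul hh.le
  have hupper : ((h * Lam) • (1 : Matrix (Fin d) (Fin d) ℝ) -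
      (√h • σ t y) * (√h • σ t y).transpose).PosSemidef := by
    rw [sqrt_smul_mul_transpose hh.le, mul_smul, ← smul_sub]
    exact (hL.bounded t ht y).smul hh.le
  rw [eulerStep_eq_affine, eulerStep_eq_affine]
  refine (dvBound_map_affine_stdGaussian (mul_pos hh hlam) (mul_pos hh hL.Lam_pos).le (hlower x)
    (hlower y) hupper _ _).mono (le_of_eq ?_)
  rw [← smul_sub, hsNormSq_smul, Real.sq_sqrt hh.le, mul_div_mul_left _ _ hh.ne',
    mul_div_mul_left _ _ hh.ne', mul_comm h lam, mul_assoc 2 lam h]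

lemma regularizing_eulerKernel (hM : MonotoneElliptic b σ T α lam)
    (hL : LipschitzBounded b σ T β Lam) (ht : t ∈ Set.Icc 0 T) (hh : 0 < h) :
    Regularizing (eulerKernel (b t) (σ t) h) (eulerRegularity α lam β Lam h) := by
  intro x y
  rcases eq_or_ne x y with rfl | hxy
  · have := isMarkovKernel_eulerKernel hM hL ht h
    simpa using DVBound.refl (eulerKernel (b t) (σ t) h x)
  have hlam := hM.lam_pos
  have hLam := hL.Lam_pos
  have hmeas := measurable_eulerStep hM hL ht h
  rw [eulerKernel, stepKernel_apply hmeas, stepKernel_apply hmeas]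
  refine (dvBound_eulerStep hM hL ht hh x y).mono ?_
  have hcon := norm_sq_drift_sub_add_le hM hL ht hh.le x y
  have hhs := hsNormSq_sub_le hM hL ht x y
  set D := ‖x + h • b t x - (y + h • b t y)‖ ^ 2
  set H := hsNormSq (σ t x - σ t y)
  set r := Lam / lam
  have hr : r ≤ r ^ 3 :=
    le_self_pow₀ ((one_le_div hlam).2 (lam_le_Lam hM hL ht hxy)) three_ne_zero
  have hH : 0 ≤ H := hsNormSq_nonneg _
  calc D / (2 * lam * h) + (1 / 2 + r) * (H / lam)
      = (D + h * H) / (2 * lam * h) + r * H / lam := by field_simp; ring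
    _ ≤ eulerContraction α β h * ‖x - y‖ ^ 2 / (2 * lam * h) +
          r ^ 3 * (2 * (β - α) * ‖x - y‖ ^ 2) / lam := by gcongr
    _ = eulerRegularity α lam β Lam h * ‖x - y‖ ^ 2 := by
        rw [eulerRegularity]
        ring

lemma eulerRegularity_pos (hlam : 0 < lam) (hLam : 0 < Lam) (hαβ : α ≤ β) (hh : 0 < h)
    (hq : 0 < eulerContraction α β h) : 0 < eulerRegularity α lam β Lam h := by
  have := sub_nonneg.2 hαβ
  unfold eulerRegularity
  positivity

end EulerStep

section EulerScheme

variable {d m : ℕ} {b : ℝ → EuclideanSpace ℝ (Fin d) → EuclideanSpace ℝ (Fin d)}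
  {σ : ℝ → EuclideanSpace ℝ (Fin d) → Matrix (Fin d) (Fin m) ℝ} {T α lam β Lam h : ℝ}
  {Ω : Type*} {ξ : ℕ → Ω → EuclideanSpace ℝ (Fin m)} {n : ℕ}

lemma euler_succ (x : EuclideanSpace ℝ (Fin d)) (n : ℕ) :
    euler b σ h ξ x (n + 1) = fun ω =>
      eulerStep (b (n * h)) (σ (n * h)) h (euler b σ h ξ x n ω) (ξ n ω) := rfl

lemma exists_measurable_euler_eq
    (hstep : ∀ i < n, Measurable (Function.uncurry (eulerStep (b (i * h)) (σ (i * h)) h)))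
    (x : EuclideanSpace ℝ (Fin d)) :
    ∃ Φ : (Finset.range n → EuclideanSpace ℝ (Fin m)) → EuclideanSpace ℝ (Fin d),
      Measurable Φ ∧ euler b σ h ξ x n = fun ω => Φ fun i => ξ i ω := by
  induction n with
  | zero => exact ⟨fun _ => x, measurable_const, rfl⟩
  | succ n ih =>
    obtain ⟨Φ, hΦ, hΦe⟩ := ih fun i hi => hstep i (by lia)
    have hsub := Finset.range_mono n.le_succ
    refine ⟨fun u => eulerStep (b (n * h)) (σ (n * h)) h (Φ fun i => u ⟨i, hsub i.2⟩)
      (u ⟨n, Finset.self_mem_range_succ n⟩), ?_, ?_⟩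
    · have hprev : Measurable fun u : Finset.range (n + 1) → EuclideanSpace ℝ (Fin m) =>
          Φ fun i => u ⟨i, hsub i.2⟩ :=
        hΦ.comp (measurable_pi_lambda _ fun i => measurable_pi_apply _)
      exact (hstep n n.lt_succ_self).comp (hprev.prodMk (measurable_pi_apply _))
    · rw [euler_succ, hΦe]

variable [MeasurableSpace Ω] {P : Measure Ω}

lemma aemeasurable_euler
    (hstep : ∀ i < n, Measurable (Function.uncurry (eulerStep (b (i * h)) (σ (i * h)) h)))
    (hξ : ∀ i, AEMeasurable (ξ i) P) (x : EuclideanSpace ℝ (Fin d)) :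
    AEMeasurable (euler b σ h ξ x n) P := by
  obtain ⟨Φ, hΦ, hΦe⟩ := exists_measurable_euler_eq (ξ := ξ) hstep x
  rw [hΦe]
  exact hΦ.comp_aemeasurable (aemeasurable_pi_lambda _ fun i => hξ i)

lemma indepFun_euler
    (hstep : ∀ i < n, Measurable (Function.uncurry (eulerStep (b (i * h)) (σ (i * h)) h)))
    (hξ : ∀ i, AEMeasurable (ξ i) P) (hindep : iIndepFun ξ P) (x : EuclideanSpace ℝ (Fin d)) :
    IndepFun (euler b σ h ξ x n) (ξ n) P := by
  obtain ⟨Φ, hΦ, hΦe⟩ := exists_measurable_euler_eq (ξ := ξ) hstep x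
  rw [hΦe]
  exact (hindep.indepFun_finset₀ (Finset.range n) {n} (by simp) hξ).comp hΦ
    (measurable_pi_apply (⟨n, Finset.mem_singleton_self n⟩ : ({n} : Finset ℕ)))

variable [IsProbabilityMeasure P]

lemma map_euler_succ
    (hstep : ∀ i < n + 1, Measurable (Function.uncurry (eulerStep (b (i * h)) (σ (i * h)) h)))
    (hindep : iIndepFun ξ P)
    (hlaw : ∀ i, HasLaw (ξ i) (stdGaussian (EuclideanSpace ℝ (Fin m))) P)
    (x : EuclideanSpace ℝ (Fin d)) :
    P.map (euler b σ h ξ x (n + 1)) =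
      eulerKernel (b (n * h)) (σ (n * h)) h ∘ₘ P.map (euler b σ h ξ x n) := by
  have hξ : ∀ i, AEMeasurable (ξ i) P := fun i => (hlaw i).aemeasurable
  have hprev : ∀ i < n, Measurable (Function.uncurry (eulerStep (b (i * h)) (σ (i * h)) h)) :=
    fun i hi => hstep i (by lia)
  exact map_step_eq_stepKernel_comp (hstep n n.lt_succ_self) (aemeasurable_euler hprev hξ x)
    (hlaw n) (indepFun_euler hprev hξ hindep x)

variable {N : ℕ}

lemma isProbabilityMeasure_map_euler (hstep : ∀ i < n,
      Measurable (Function.uncurry (eulerStep (b (i * h)) (σ (i * h)) h)))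
    (hlaw : ∀ i, HasLaw (ξ i) (stdGaussian (EuclideanSpace ℝ (Fin m))) P)
    (x : EuclideanSpace ℝ (Fin d)) : IsProbabilityMeasure (P.map (euler b σ h ξ x n)) :=
  Measure.isProbabilityMeasure_map
    (aemeasurable_euler hstep (fun i => (hlaw i).aemeasurable) x)

lemma natCast_mul_mem_Icc (hh : 0 ≤ h) (hT : N * h ≤ T) (hn : n < N) :
    (n : ℝ) * h ∈ Set.Icc 0 T :=
  ⟨by positivity, le_trans (by gcongr) hT⟩

lemma measurable_eulerStep_of_lt (hM : MonotoneElliptic b σ T α lam)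
    (hL : LipschitzBounded b σ T β Lam) (hh : 0 ≤ h) (hT : N * h ≤ T) :
    ∀ i < N, Measurable (Function.uncurry (eulerStep (b (i * h)) (σ (i * h)) h)) :=
  fun _ hi => measurable_eulerStep hM hL (natCast_mul_mem_Icc hh hT hi) h

theorem dvBound_euler (hM : MonotoneElliptic b σ T α lam) (hL : LipschitzBounded b σ T β Lam)
    (hh : 0 < h) (hN : 1 ≤ N) (hT : N * h ≤ T) (hindep : iIndepFun ξ P)
    (hlaw : ∀ i, HasLaw (ξ i) (stdGaussian (EuclideanSpace ℝ (Fin m))) P)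
    (hq : 0 < eulerContraction α β h) (x y : EuclideanSpace ℝ (Fin d)) :
    DVBound (P.map (euler b σ h ξ x N)) (P.map (euler b σ h ξ y N))
      (eulerRegularity α lam β Lam h /
        (∑ i ∈ Finset.range N, (eulerContraction α β h)⁻¹ ^ i) * ‖x - y‖ ^ 2) := by
  have hstep := measurable_eulerStep_of_lt hM hL hh.le hT
  have htime : ∀ n < N, (n : ℝ) * h ∈ Set.Icc 0 T := fun n hn => natCast_mul_mem_Icc hh.le hT hn
  rcases eq_or_ne x y with rfl | hxy
  · have := isProbabilityMeasure_map_euler hstep hlaw x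
    simpa using DVBound.refl (P.map (euler b σ h ξ x N))
  have hC := eulerRegularity_pos hM.lam_pos hL.Lam_pos
    (alpha_le_beta hM hL (htime 0 hN) hxy) hh hq
  have hinit : ∀ x, P.map (euler b σ h ξ x 0) = .dirac x := fun x => by
    simp only [euler, Measure.map_const, measure_univ, one_smul]
  have hsucc : ∀ x, ∀ n < N, P.map (euler b σ h ξ x (n + 1)) =
      eulerKernel (b (n * h)) (σ (n * h)) h ∘ₘ P.map (euler b σ h ξ x n) := fun x n hn =>
    map_euler_succ (fun i hi => hstep i (hi.trans_le hn)) hindep hlaw x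
  exact dvBound_of_regularizing_of_contracting (μ := fun n => P.map (euler b σ h ξ x n))
    (ν := fun n => P.map (euler b σ h ξ y n)) hC hq (hinit x) (hinit y) hN
    (fun n hn => isMarkovKernel_eulerKernel hM hL (htime n hn) h)
    (fun n hn => regularizing_eulerKernel hM hL (htime n hn) hh)
    (fun n hn => meanSquareContracting_eulerKernel hM hL (htime n hn) hh.le) (hsucc x) (hsucc y)

theorem klDiv_euler_le (hM : MonotoneElliptic b σ T α lam) (hL : LipschitzBounded b σ T β Lam)
    (hh : 0 < h) (hN : 1 ≤ N) (hT : N * h ≤ T) (hindep : iIndepFun ξ P)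
    (hlaw : ∀ i, HasLaw (ξ i) (stdGaussian (EuclideanSpace ℝ (Fin m))) P)
    (hq : 0 < eulerContraction α β h) (x y : EuclideanSpace ℝ (Fin d)) :
    klDiv (P.map (euler b σ h ξ x N)) (P.map (euler b σ h ξ y N)) ≤
      ENNReal.ofReal (eulerRegularity α lam β Lam h /
        (∑ i ∈ Finset.range N, (eulerContraction α β h)⁻¹ ^ i) * ‖x - y‖ ^ 2) := by
  have hprob := isProbabilityMeasure_map_euler (measurable_eulerStep_of_lt hM hL hh.le hT) hlaw
  have := hprob x
  have := hprob y
  exact (dvBound_euler hM hL hh hN hT hindep hlaw hq x y).klDiv_le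

end EulerScheme

section Constants

variable {α lam β Lam h L : ℝ} {N : ℕ}

lemma eulerRegularity_eq (hlam : lam ≠ 0) (hh : h ≠ 0) (hL : L ≠ 0)
    (hq : L ^ 2 = eulerContraction α β h) :
    eulerRegularity α lam β Lam h =
      (1 + 4 * (β - α) * (Lam / lam) ^ 3 * h / L ^ 2) * (L ^ 2 / (2 * lam * h)) := by
  rw [eulerRegularity, ← hq]
  generalize Lam / lam = r
  field_simp
  ring

lemma inv_sq_pow_eq_zpow : (L ^ 2)⁻¹ ^ N = L ^ (-(2 * (N : ℤ))) := by
  rw [zpow_neg, zpow_mul, zpow_natCast, inv_pow]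
  norm_cast

lemma one_lt_zpow_neg_two_mul (hL : 0 < L) (hL1 : L < 1) (hN : N ≠ 0) :
    1 < L ^ (-(2 * (N : ℤ))) := by
  rw [← inv_sq_pow_eq_zpow]
  exact one_lt_pow₀ ((one_lt_inv₀ (by positivity)).2 (pow_lt_one₀ hL.le hL1 two_ne_zero)) hN

lemma eulerRegularity_div_geom_sum (hlam : lam ≠ 0) (hh : h ≠ 0) (hL : 0 < L)
    (hq : L ^ 2 = eulerContraction α β h) (hL1 : L ≠ 1) :
    eulerRegularity α lam β Lam h / ∑ i ∈ Finset.range N, (eulerContraction α β h)⁻¹ ^ i =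
      (1 + 4 * (β - α) * (Lam / lam) ^ 3 * h / L ^ 2) *
        ((α - β ^ 2 * h / 2) / (lam * (L ^ (-(2 * (N : ℤ))) - 1))) := by
  have hsq : L ^ 2 ≠ 1 := mt (pow_eq_one_iff_of_nonneg hL.le two_ne_zero).1 hL1
  have hnum : α - β ^ 2 * h / 2 = (1 - L ^ 2) / (2 * h) := by
    rw [hq, eulerContraction]
    field_simp
    ring
  have hratio : (L ^ 2)⁻¹ - 1 = (1 - L ^ 2) / L ^ 2 := by field_simp
  rw [eulerRegularity_eq hlam hh hL.ne' hq, ← hq, geom_sum_eq (mt inv_eq_one.1 hsq),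
    inv_sq_pow_eq_zpow, hnum, hratio, mul_div_assoc]
  have := sub_ne_zero.2 hsq.symm
  generalize L ^ (-(2 * (N : ℤ))) - 1 = s
  field_simp

lemma eulerRegularity_div_geom_sum_of_eq_one (hlam : lam ≠ 0) (hh : h ≠ 0) (hN : N ≠ 0)
    (hq : L ^ 2 = eulerContraction α β h) (hL1 : L = 1) :
    eulerRegularity α lam β Lam h / ∑ i ∈ Finset.range N, (eulerContraction α β h)⁻¹ ^ i =
      (1 + 4 * (β - α) * (Lam / lam) ^ 3 * h / L ^ 2) * (1 / (2 * lam * (N * h))) := by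
  subst hL1
  rw [eulerRegularity_eq hlam hh one_ne_zero hq, ← hq]
  simp only [one_pow, inv_one, Finset.sum_const, Finset.card_range, nsmul_one]
  field_simp

lemma coeff_le_coeff_of_lt_one (hlam : 0 < lam) (hLam : 0 < Lam) (hβ : 0 < β) (hαβ : α ≤ β)
    (hh : 0 < h) (hN : N ≠ 0) (hL : 0 < L) (hL1 : L < 1) :
    (1 + 4 * (β - α) * (Lam / lam) ^ 3 * h / L ^ 2) *
        ((α - β ^ 2 * h / 2) / (lam * (L ^ (-(2 * (N : ℤ))) - 1))) ≤
      (1 + 4 * (β - α) * (Lam / lam) ^ 3 * h / L ^ 2) *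
        (α * (1 - β * h / 2) / (lam * (L ^ (-(2 * (N : ℤ))) - 1))) := by
  have := sub_nonneg.2 hαβ
  have hden := sub_pos.2 (one_lt_zpow_neg_two_mul hL hL1 hN)
  gcongr
  have : 0 ≤ (β - α) * (β * h) := by positivity
  linarith

end Constants

section Limit

variable {α lam β Lam T : ℝ} {h : ℕ → ℝ} {N : ℕ → ℕ}

lemma hasDerivAt_log_eulerContraction (α β : ℝ) :
    HasDerivAt (fun h => Real.log (eulerContraction α β h)) (-(2 * α)) 0 := by
  have hquad : HasDerivAt (eulerContraction α β) (-(2 * α)) 0 := by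
    unfold eulerContraction
    simpa using (((hasDerivAt_id' (0 : ℝ)).const_mul (2 * α)).const_sub 1).fun_add
      (((hasDerivAt_id' (0 : ℝ)).fun_pow 2).const_mul (β ^ 2))
  simpa [eulerContraction] using hquad.log (by simp [eulerContraction])

lemma tendsto_eulerContraction (α β : ℝ) (h0 : Tendsto h atTop (𝓝 0)) :
    Tendsto (fun k => eulerContraction α β (h k)) atTop (𝓝 1) := by
  have hcont : Continuous (eulerContraction α β) := by
    unfold eulerContraction
    fun_prop
  have hzero : eulerContraction α β 0 = 1 := by simp [eulerContraction]
  exact hzero ▸ (hcont.tendsto 0).comp h0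

lemma tendsto_inv_eulerContraction_pow (α β : ℝ) (hpos : ∀ k, 0 < h k)
    (h0 : Tendsto h atTop (𝓝 0)) (hT : Tendsto (fun k => N k * h k) atTop (𝓝 T)) :
    Tendsto (fun k => (eulerContraction α β (h k))⁻¹ ^ N k) atTop
      (𝓝 (Real.exp (2 * α * T))) := by
  have hslope : Tendsto (fun k => Real.log (eulerContraction α β (h k)) / h k) atTop
      (𝓝 (-(2 * α))) := by
    refine ((hasDerivAt_log_eulerContraction α β).tendsto_slope.comp (tendsto_nhdsWithin_iff.2
      ⟨h0, .of_forall fun k => (hpos k).ne'⟩)).congr fun k => ?_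
    simp [slope_def_field, eulerContraction]
  have hexp := (hT.mul hslope).neg.rexp
  rw [show -(T * -(2 * α)) = 2 * α * T by ring] at hexp
  refine hexp.congr' ?_
  filter_upwards [(tendsto_eulerContraction α β h0).eventually_const_lt one_pos] with k hk
  rw [mul_assoc, mul_div_cancel₀ _ (hpos k).ne', Real.exp_neg, Real.exp_nat_mul, Real.exp_log hk,
    inv_pow]

lemma tendsto_mul_eulerRegularity (α lam β Lam : ℝ) (hpos : ∀ k, 0 < h k)
    (h0 : Tendsto h atTop (𝓝 0)) :
    Tendsto (fun k => h k * eulerRegularity α lam β Lam (h k)) atTop (𝓝 (1 / (2 * lam))) := by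
  have hlim := ((tendsto_eulerContraction α β h0).div_const (2 * lam)).add
    (h0.mul_const (2 * (β - α) * (Lam / lam) ^ 3 / lam))
  rw [zero_mul, add_zero] at hlim
  refine hlim.congr fun k => ?_
  have := (hpos k).ne'
  rw [eulerRegularity]
  field_simp

lemma tendsto_mul_geom_sum (hα : α ≠ 0) (hpos : ∀ k, 0 < h k) (h0 : Tendsto h atTop (𝓝 0))
    (hT : Tendsto (fun k => N k * h k) atTop (𝓝 T)) :
    Tendsto (fun k => h k * ∑ i ∈ Finset.range (N k), (eulerContraction α β (h k))⁻¹ ^ i) atTop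
      (𝓝 ((Real.exp (2 * α * T) - 1) / (2 * α))) := by
  have hq := tendsto_eulerContraction α β h0
  have hrate : Tendsto (fun k => (2 * α - β ^ 2 * h k) / eulerContraction α β (h k)) atTop
      (𝓝 (2 * α)) := by
    have hlim := ((h0.const_mul (β ^ 2)).const_sub (2 * α)).div hq one_ne_zero
    rwa [mul_zero, sub_zero, div_one] at hlim
  have hα2 := mul_ne_zero two_ne_zero hα
  refine (((tendsto_inv_eulerContraction_pow α β hpos h0 hT).sub_const 1).div hrate hα2).congr' ?_
  filter_upwards [hq.eventually_const_lt one_pos, hrate.eventually_ne hα2] with k hk hrk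
  have hsub : (eulerContraction α β (h k))⁻¹ - 1 =
      h k * ((2 * α - β ^ 2 * h k) / eulerContraction α β (h k)) := by
    rw [inv_eq_one_div, div_sub_one hk.ne', ← mul_div_assoc]
    congr 1
    rw [eulerContraction]
    ring
  have hne : (eulerContraction α β (h k))⁻¹ ≠ 1 := by
    rw [← sub_ne_zero, hsub]
    exact mul_ne_zero (hpos k).ne' hrk
  rw [Pi.div_apply, geom_sum_eq hne, hsub, ← mul_div_assoc, mul_div_mul_left _ _ (hpos k).ne']

lemma tendsto_mul_geom_sum_zero (hpos : ∀ k, 0 < h k) (h0 : Tendsto h atTop (𝓝 0))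
    (hT : Tendsto (fun k => N k * h k) atTop (𝓝 T)) :
    Tendsto (fun k => h k * ∑ i ∈ Finset.range (N k), (eulerContraction 0 β (h k))⁻¹ ^ i) atTop
      (𝓝 T) := by
  have hlower : Tendsto (fun k => N k * h k * (eulerContraction 0 β (h k))⁻¹ ^ N k) atTop
      (𝓝 T) := by
    simpa using hT.mul (tendsto_inv_eulerContraction_pow 0 β hpos h0 hT)
  have hq : ∀ k, 1 ≤ eulerContraction 0 β (h k) := fun k => by
    rw [eulerContraction, mul_zero, zero_mul, sub_zero, le_add_iff_nonneg_right]
    positivity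
  have hq0 : ∀ k, 0 ≤ (eulerContraction 0 β (h k))⁻¹ := fun k =>
    inv_nonneg.2 (zero_le_one.trans (hq k))
  refine tendsto_of_tendsto_of_tendsto_of_le_of_le hlower hT (fun k => ?_) fun k => ?_
  · have := Finset.card_nsmul_le_sum (Finset.range (N k)) _ _ fun i hi =>
      pow_le_pow_of_le_one (hq0 k) (inv_le_one_of_one_le₀ (hq k)) (Finset.mem_range.1 hi).le
    rw [Finset.card_range, nsmul_eq_mul] at this
    rw [mul_comm (N k : ℝ), mul_assoc]
    exact mul_le_mul_of_nonneg_left this (hpos k).le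
  · have := Finset.sum_le_card_nsmul (Finset.range (N k)) _ _ fun i _ =>
      pow_le_one₀ (n := i) (hq0 k) (inv_le_one_of_one_le₀ (hq k))
    rw [Finset.card_range, nsmul_one] at this
    rw [mul_comm (N k : ℝ)]
    exact mul_le_mul_of_nonneg_left this (hpos k).le

theorem klDiv_le_of_weaklyTendsto_euler {d m : ℕ}
    {b : ℝ → EuclideanSpace ℝ (Fin d) → EuclideanSpace ℝ (Fin d)}
    {σ : ℝ → EuclideanSpace ℝ (Fin d) → Matrix (Fin d) (Fin m) ℝ} {S s : ℝ}
    {Ω : Type*} [MeasurableSpace Ω] {P : Measure Ω} [IsProbabilityMeasure P]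
    {ξ : ℕ → Ω → EuclideanSpace ℝ (Fin m)} (hM : MonotoneElliptic b σ S α lam)
    (hL : LipschitzBounded b σ S β Lam) (hindep : iIndepFun ξ P)
    (hlaw : ∀ i, HasLaw (ξ i) (stdGaussian (EuclideanSpace ℝ (Fin m))) P)
    (hpos : ∀ k, 0 < h k) (hS : ∀ k, N k * h k ≤ S) (h0 : Tendsto h atTop (𝓝 0)) (hs : s ≠ 0)
    (hsum : Tendsto (fun k => h k * ∑ i ∈ Finset.range (N k), (eulerContraction α β (h k))⁻¹ ^ i)
      atTop (𝓝 s))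
    {x y : EuclideanSpace ℝ (Fin d)} {μ ν : Measure (EuclideanSpace ℝ (Fin d))}
    [IsProbabilityMeasure μ] [IsProbabilityMeasure ν]
    (hμ : WeaklyTendsto (fun k => P.map (euler b σ (h k) ξ x (N k))) μ)
    (hν : WeaklyTendsto (fun k => P.map (euler b σ (h k) ξ y (N k))) ν) :
    klDiv μ ν ≤ ENNReal.ofReal (‖x - y‖ ^ 2 / (2 * lam * s)) := by
  have hconst : Tendsto (fun k => eulerRegularity α lam β Lam (h k) /
      (∑ i ∈ Finset.range (N k), (eulerContraction α β (h k))⁻¹ ^ i) * ‖x - y‖ ^ 2) atTop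
      (𝓝 (‖x - y‖ ^ 2 / (2 * lam * s))) := by
    have hlim := ((tendsto_mul_eulerRegularity α lam β Lam hpos h0).div hsum hs).mul_const
      (‖x - y‖ ^ 2)
    rw [div_div, one_div_mul_eq_div] at hlim
    refine hlim.congr fun k => ?_
    rw [Pi.div_apply, mul_div_mul_left _ _ (hpos k).ne']
  have hbound : ∀ᶠ k in atTop, DVBound (P.map (euler b σ (h k) ξ x (N k)))
      (P.map (euler b σ (h k) ξ y (N k))) (eulerRegularity α lam β Lam (h k) /
        (∑ i ∈ Finset.range (N k), (eulerContraction α β (h k))⁻¹ ^ i) * ‖x - y‖ ^ 2) := by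
    filter_upwards [(tendsto_eulerContraction α β h0).eventually_const_lt one_pos,
      hsum.eventually_ne hs] with k hq hne
    have hN : N k ≠ 0 := fun hzero => hne (by simp [hzero])
    exact dvBound_euler hM hL (hpos k) (Nat.one_le_iff_ne_zero.2 hN) (hS k) hindep hlaw hq x y
  exact (DVBound.of_weaklyTendsto hbound hμ hν hconst).klDiv_le

end Limit

end MultNoise

theorem theorem5p3 {d m : ℕ}
    (b : ℝ → EuclideanSpace ℝ (Fin d) → EuclideanSpace ℝ (Fin d))
    (σ : ℝ → EuclideanSpace ℝ (Fin d) → Matrix (Fin d) (Fin m) ℝ)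
    (α lam β Lam : ℝ)
    {Ω : Type*} [MeasurableSpace Ω] (P : Measure Ω) [IsProbabilityMeasure P]
    (ξ : ℕ → Ω → EuclideanSpace ℝ (Fin m))
    (hξ_indep : iIndepFun ξ P)
    (hξ_law : ∀ n, HasLaw (ξ n) (stdGaussian (EuclideanSpace ℝ (Fin m))) P)
    (x y : EuclideanSpace ℝ (Fin d)) :
    -- the bound for the Euler scheme
    (∀ (h : ℝ) (N : ℕ), 0 < h → 1 ≤ N →
      MultNoise.MonotoneElliptic b σ (N * h) α lam →
      MultNoise.LipschitzBounded b σ (N * h) β Lam →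
      ∀ L : ℝ, 0 < L → L ^ 2 = 1 - 2 * α * h + β ^ 2 * h ^ 2 →
        (L ≠ 1 →
          klDiv (P.map (MultNoise.euler b σ h ξ x N)) (P.map (MultNoise.euler b σ h ξ y N)) ≤
            ENNReal.ofReal
              ((1 + 4 * (β - α) * (Lam / lam) ^ 3 * h / L ^ 2) *
                ((α - β ^ 2 * h / 2) / (lam * (L ^ (-(2 * (N : ℤ))) - 1))) * ‖x - y‖ ^ 2)) ∧
        (L = 1 →
          klDiv (P.map (MultNoise.euler b σ h ξ x N)) (P.map (MultNoise.euler b σ h ξ y N)) ≤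
            ENNReal.ofReal
              ((1 + 4 * (β - α) * (Lam / lam) ^ 3 * h / L ^ 2) *
                (1 / (2 * lam * (N * h))) * ‖x - y‖ ^ 2)) ∧
        (L < 1 →
          klDiv (P.map (MultNoise.euler b σ h ξ x N)) (P.map (MultNoise.euler b σ h ξ y N)) ≤
            ENNReal.ofReal
              ((1 + 4 * (β - α) * (Lam / lam) ^ 3 * h / L ^ 2) *
                (α * (1 - β * h / 2) / (lam * (L ^ (-(2 * (N : ℤ))) - 1))) * ‖x - y‖ ^ 2))) ∧
    -- the limit as the step size tends to zero
    (∀ T S : ℝ, 0 < T →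
      MultNoise.MonotoneElliptic b σ S α lam →
      MultNoise.LipschitzBounded b σ S β Lam →
      ∀ (h : ℕ → ℝ) (N : ℕ → ℕ), (∀ k, 0 < h k) → (∀ k, N k * h k ≤ S) →
        Tendsto h atTop (𝓝 0) → Tendsto (fun k => N k * h k) atTop (𝓝 T) →
        ∀ (μ ν : Measure (EuclideanSpace ℝ (Fin d))) [IsProbabilityMeasure μ]
          [IsProbabilityMeasure ν],
          MultNoise.WeaklyTendsto (fun k => P.map (MultNoise.euler b σ (h k) ξ x (N k))) μ →
          MultNoise.WeaklyTendsto (fun k => P.map (MultNoise.euler b σ (h k) ξ y (N k))) ν →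
          (α ≠ 0 → klDiv μ ν ≤
            ENNReal.ofReal (α * ‖x - y‖ ^ 2 / (lam * (Real.exp (2 * α * T) - 1)))) ∧
          (α = 0 → klDiv μ ν ≤ ENNReal.ofReal (‖x - y‖ ^ 2 / (2 * lam * T)))) := by
  constructor
  · intro h N hh hN hM hL L hLpos hq
    have hN0 : N ≠ 0 := Nat.one_le_iff_ne_zero.1 hN
    have hKL := MultNoise.klDiv_euler_le hM hL hh hN le_rfl hξ_indep hξ_law
      ((pow_pos hLpos 2).trans_eq hq) x y
    have hne := fun hL1 => MultNoise.eulerRegularity_div_geom_sum (β := β) (Lam := Lam) (N := N)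
      hM.lam_pos.ne' hh.ne' hLpos hq hL1 ▸ hKL
    refine ⟨hne, fun hL1 => ?_, fun hL1 => (hne hL1.ne).trans (ENNReal.ofReal_le_ofReal ?_)⟩
    · rwa [MultNoise.eulerRegularity_div_geom_sum_of_eq_one hM.lam_pos.ne' hh.ne' hN0 hq hL1]
        at hKL
    · rcases eq_or_ne x y with rfl | hxy
      · simp
      exact mul_le_mul_of_nonneg_right (MultNoise.coeff_le_coeff_of_lt_one hM.lam_pos hL.Lam_pos
        hL.beta_pos (MultNoise.alpha_le_beta hM hL ⟨le_rfl, by positivity⟩ hxy) hh hN0 hLpos hL1)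
        (sq_nonneg _)
  · intro T S hT hM hL h N hh hS h0 hNT μ ν _ _ hμ hν
    have hlimit := fun s hs hsum => MultNoise.klDiv_le_of_weaklyTendsto_euler (s := s) hM hL
      hξ_indep hξ_law hh hS h0 hs hsum hμ hν
    refine ⟨fun hα => ?_, ?_⟩
    · have hexp : Real.exp (2 * α * T) - 1 ≠ 0 :=
        sub_ne_zero.2 (mt (Real.exp_eq_one_iff _).1 (by positivity))
      convert hlimit _ (by positivity) (MultNoise.tendsto_mul_geom_sum hα hh h0 hNT) using 2
      field_simp
    · rintro rfl
      exact hlimit T hT.ne' (MultNoise.tendsto_mul_geom_sum_zero hh h0 hNT)
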